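/- The \textsc{Lobbying} problem has as input a matrix $A\in\{0,1\}^{w\times m}$ and an integer $k\ge 0$, and asks whether one can choose $k$ rows of $A$ and flip all $0$s in these rows to $1$s so that in the resulting matrix every column has more $1$s than $0$s. \textsc{Lobbying} can be solved in time $2^{O(m^2)}\cdot w^{O(1)}$. Precisely: there are a single random access machine program $P$ and a constant $C$ such that, for all $w,m,k\ge 0$ and every $A\in\{0,1\}^{w\times m}$, the program $P$ on input $(A,k)$ halts after at most $C\cdot 2^{Cm^2}\cdot (w+1)^{C}$ steps, with output $1$ if $(A,k)$ is a yes-instance of \textsc{Lobbying} and with output $0$ otherwise. Here the machine has registers and memory cells that hold natural numbers; its unit-cost instructions are the assignment of a constant, addition, truncated subtraction, indirect reading and writing of memory cells, and tests of a register for zero (there is no unit-cost multiplication). The input is given as $w$, $m$ and $k$ in one register each and the entries of $A$ in one memory cell each, in row-major order. -/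

import Mathlib

/-! ### The problem -/

/-- The matrix obtained from `A` by turning every entry of the rows in `S` into a `1`
(`true` is the entry `1`, `false` is the entry `0`). -/
def flipRows {w m : ℕ} (A : Matrix (Fin w) (Fin m) Bool) (S : Finset (Fin w)) :
    Matrix (Fin w) (Fin m) Bool :=
  fun i j => if i ∈ S then true else A i j

/-- Every column has (strictly) more `1`s than `0`s. -/
def ColumnMajorities {w m : ℕ} (A : Matrix (Fin w) (Fin m) Bool) : Prop :=
  ∀ j : Fin m,
    (Finset.univ.filter fun i : Fin w => A i j = false).card <
      (Finset.univ.filter fun i : Fin w => A i j = true).card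

/-- The instance `(A, k)` of Lobbying is a yes-instance. -/
def Lobbying {w m : ℕ} (A : Matrix (Fin w) (Fin m) Bool) (k : ℕ) : Prop :=
  ∃ S : Finset (Fin w), S.card = k ∧ ColumnMajorities (flipRows A S)

/-! ### The machine model

A random access machine: registers and a memory whose cells hold natural numbers, addition, cut-off
subtraction and indirect addressing, each at unit cost. There is deliberately no multiplication at
unit cost: a single step then lengthens the largest number by at most one bit, so that step counts
are polynomially related to Turing machine time. Programs are finite, with structured control flow. -/

namespace RAM

/-- A machine state: the contents of the registers and of the memory cells. -/
structure State where
  reg : ℕ → ℕ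
  mem : ℕ → ℕ

/-- Programs. The arguments `d`, `a`, `b` are register numbers that are fixed in the program text. -/
inductive Prog where
  /-- no operation -/
  | skip : Prog
  /-- `reg d := n` -/
  | const (d n : ℕ) : Prog
  /-- `reg d := reg a + reg b` -/
  | add (d a b : ℕ) : Prog
  /-- `reg d := max (reg a - reg b) 0` -/
  | sub (d a b : ℕ) : Prog
  /-- `reg d := mem (reg a)` -/
  | load (d a : ℕ) : Prog
  /-- `mem (reg a) := reg b` -/
  | store (a b : ℕ) : Prog
  /-- first `p`, then `q` -/
  | seq (p q : Prog) : Prog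
  /-- if `reg a ≠ 0` then `p` else `q` -/
  | cond (a : ℕ) (p q : Prog) : Prog
  /-- while `reg a ≠ 0` do `p` -/
  | loop (a : ℕ) (p : Prog) : Prog

/-- Write `n` into register `d`. -/
def State.setReg (s : State) (d n : ℕ) : State :=
  { s with reg := Function.update s.reg d n }

/-- Write `n` into the memory cell with address `x`. -/
def State.setMem (s : State) (x n : ℕ) : State :=
  { s with mem := Function.update s.mem x n }

/-- `Exec p s s' t`: started in state `s`, the program `p` halts in state `s'` after exactly `t`
steps, where every basic instruction and every evaluation of a test is one step. -/
inductive Exec : Prog → State → State → ℕ → Prop where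
  | skip (s : State) : Exec .skip s s 1
  | const (s : State) (d n : ℕ) : Exec (.const d n) s (s.setReg d n) 1
  | add (s : State) (d a b : ℕ) : Exec (.add d a b) s (s.setReg d (s.reg a + s.reg b)) 1
  | sub (s : State) (d a b : ℕ) : Exec (.sub d a b) s (s.setReg d (s.reg a - s.reg b)) 1
  | load (s : State) (d a : ℕ) : Exec (.load d a) s (s.setReg d (s.mem (s.reg a))) 1
  | store (s : State) (a b : ℕ) : Exec (.store a b) s (s.setMem (s.reg a) (s.reg b)) 1
  | seq {p q : Prog} {s s₁ s₂ : State} {t₁ t₂ : ℕ} :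
      Exec p s s₁ t₁ → Exec q s₁ s₂ t₂ → Exec (.seq p q) s s₂ (t₁ + t₂)
  | cond_true {a : ℕ} {p q : Prog} {s s₁ : State} {t : ℕ} :
      s.reg a ≠ 0 → Exec p s s₁ t → Exec (.cond a p q) s s₁ (t + 1)
  | cond_false {a : ℕ} {p q : Prog} {s s₁ : State} {t : ℕ} :
      s.reg a = 0 → Exec q s s₁ t → Exec (.cond a p q) s s₁ (t + 1)
  | loop_done {a : ℕ} {p : Prog} {s : State} :
      s.reg a = 0 → Exec (.loop a p) s s 1
  | loop_step {a : ℕ} {p : Prog} {s s₁ s₂ : State} {t₁ t₂ : ℕ} :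
      s.reg a ≠ 0 → Exec p s s₁ t₁ → Exec (.loop a p) s₁ s₂ t₂ →
        Exec (.loop a p) s s₂ (t₁ + t₂ + 1)

/-- The machine is deterministic: the final state and the number of steps are determined by the
program and the initial state. -/
theorem Exec.deterministic {p : Prog} {s s₁ : State} {t₁ : ℕ} (h₁ : Exec p s s₁ t₁) :
    ∀ {s₂ : State} {t₂ : ℕ}, Exec p s s₂ t₂ → s₁ = s₂ ∧ t₁ = t₂ := by
  induction h₁ with
  | skip | const | add | sub | load | store => intro _ _ h; cases h; exact ⟨rfl, rfl⟩
  | seq _ _ ih₁ ih₂ =>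
    intro _ _ h
    cases h with
    | seq g₁ g₂ =>
      obtain ⟨rfl, rfl⟩ := ih₁ g₁
      obtain ⟨rfl, rfl⟩ := ih₂ g₂
      exact ⟨rfl, rfl⟩
  | cond_true h0 _ ih =>
    intro _ _ h
    cases h with
    | cond_true _ g => obtain ⟨rfl, rfl⟩ := ih g; exact ⟨rfl, rfl⟩
    | cond_false g0 _ => exact absurd g0 h0
  | cond_false h0 _ ih =>
    intro _ _ h
    cases h with
    | cond_true g0 _ => exact absurd h0 g0
    | cond_false _ g => obtain ⟨rfl, rfl⟩ := ih g; exact ⟨rfl, rfl⟩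
  | loop_done h0 =>
    intro _ _ h
    cases h with
    | loop_done _ => exact ⟨rfl, rfl⟩
    | loop_step g0 _ _ => exact absurd h0 g0
  | loop_step h0 _ _ ih₁ ih₂ =>
    intro _ _ h
    cases h with
    | loop_done g0 => exact absurd g0 h0
    | loop_step _ g₁ g₂ =>
      obtain ⟨rfl, rfl⟩ := ih₁ g₁
      obtain ⟨rfl, rfl⟩ := ih₂ g₂
      exact ⟨rfl, rfl⟩

/-- The initial state on the input `(A, k)`: registers `0`, `1`, `2` hold `w`, `m`, `k`; the entry of
`A` in row `i` and column `j` (counted from `0`) is in the memory cell with address `i * m + j`;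
everything else is `0`. -/
def inputState {w m : ℕ} (A : Matrix (Fin w) (Fin m) Bool) (k : ℕ) : State where
  reg := fun r => if r = 0 then w else if r = 1 then m else if r = 2 then k else 0
  mem := fun x =>
    if h : x < w * m then
      if A (Fin.divNat (n := m) ⟨x, h⟩) (Fin.modNat (m := w) ⟨x, h⟩) = true then 1 else 0
    else 0

/-- The memory cell with address `i * m + j` initially holds the entry in row `i`, column `j`. -/
theorem inputState_mem {w m : ℕ} (A : Matrix (Fin w) (Fin m) Bool) (k : ℕ) (i : Fin w) (j : Fin m) :
    (inputState A k).mem ((i : ℕ) * m + (j : ℕ)) = if A i j = true then 1 else 0 := by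
  have hj := j.isLt
  have hm : 0 < m := by omega
  have h : (i : ℕ) * m + (j : ℕ) < w * m := by
    have := Nat.mul_le_mul_right m (Nat.succ_le_of_lt i.isLt)
    rw [Nat.succ_mul] at this
    omega
  have h1 : Fin.divNat (n := m) (⟨(i : ℕ) * m + (j : ℕ), h⟩ : Fin (w * m)) = i := by
    ext
    simp [Fin.divNat, Nat.add_comm, Nat.add_mul_div_right _ _ hm, Nat.div_eq_of_lt hj]
  have h2 : Fin.modNat (m := w) (⟨(i : ℕ) * m + (j : ℕ), h⟩ : Fin (w * m)) = j := by
    ext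
    simp [Fin.modNat, Nat.add_comm, Nat.mod_eq_of_lt hj]
  simp only [inputState, h, dif_pos, h1, h2]

end RAM

/-! Flipping `k` rows means keeping `w - k` rows, and a set of rows can be kept iff in each column
`1 + 2 * (zeros among the kept rows) ≤ w` (`columnMajorities_iff`). Only the number `y Z` of kept
rows of each of the at most `2 ^ m` row types matters (`mem_Vals_start`). It remains to maximise `∑
y Z` subject to `m` linear constraints and `y Z ≤ U Z`, where `U Z` is the multiplicity of the type.
Since keepability passes to subsets, the maximum decides the instance.

The maximum is found by scaling. A state is a vector `p`, a value, a bound `b` and multiplicities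
`U`, with the requirement `p + 2 * ∑ y Z * z Z ≤ b`. Write `y = y' + 2 * x` with `x Z ≤ (U Z - 1) /
2` and `y' Z ≤ odds (U Z) ≤ 2`. Dividing the requirement by two, with the rounding of `p` dictated
by the parity of `b`, gives one of the same shape for `x`, with bound `b / 2`, doubled weight and
the vector `halfVec p + ∑ y' Z * z Z`; nothing is gained or lost (`Vals_step`). Once `U` and `b`
have reached zero, only the zero vector is admissible.

A level halves the entries and then adds at most two items per occurring type, so entries never
exceed `4 * 2 ^ m + 1`, whatever `w` is (`Items_half_le`). The vectors can therefore be coded in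
base `K = 8 * 2 ^ m`, and a table of `K ^ m = 2 ^ (m * (m + 3))` cells stores the best value for
each vector (`Rep`). Each level costs a polynomial in `K ^ m` and `w`, and `w` levels are more than
enough, which gives the bound (`step_bound`).

On the machine a level is one in-place pass that moves every entry to its halved index
(`wp_pushProg`), followed by knapsack updates (`wp_addItemProg`); `wp_levelProg` joins these to
`Vals_step`. -/

namespace RAM

/-! ### Total correctness with step counts -/

/-- `WP p s Q`: started in `s`, the program `p` halts, and the final state and the number of steps
satisfy `Q`. -/
def WP (p : Prog) (s : State) (Q : State → ℕ → Prop) : Prop :=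
  ∃ s' t, Exec p s s' t ∧ Q s' t

theorem WP.mono {p : Prog} {s : State} {Q Q' : State → ℕ → Prop} (h : WP p s Q)
    (hQ : ∀ s' t, Q s' t → Q' s' t) : WP p s Q' := by
  obtain ⟨s', t, he, hq⟩ := h
  exact ⟨s', t, he, hQ _ _ hq⟩

section Rules

variable {s : State} {Q : State → ℕ → Prop}

/-- The rules for single instructions, sequencing and tests are equivalences, so that rewriting with
them executes loop-free code symbolically. -/
theorem wp_skip : WP .skip s Q ↔ Q s 1 :=
  ⟨fun ⟨_, _, h, hq⟩ => by cases h; exact hq, fun h => ⟨_, _, .skip s, h⟩⟩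

theorem wp_const {d n : ℕ} : WP (.const d n) s Q ↔ Q (s.setReg d n) 1 :=
  ⟨fun ⟨_, _, h, hq⟩ => by cases h; exact hq, fun h => ⟨_, _, .const s d n, h⟩⟩

theorem wp_add {d a b : ℕ} :
    WP (.add d a b) s Q ↔ Q (s.setReg d (s.reg a + s.reg b)) 1 :=
  ⟨fun ⟨_, _, h, hq⟩ => by cases h; exact hq, fun h => ⟨_, _, .add s d a b, h⟩⟩

theorem wp_sub {d a b : ℕ} :
    WP (.sub d a b) s Q ↔ Q (s.setReg d (s.reg a - s.reg b)) 1 :=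
  ⟨fun ⟨_, _, h, hq⟩ => by cases h; exact hq, fun h => ⟨_, _, .sub s d a b, h⟩⟩

theorem wp_load {d a : ℕ} : WP (.load d a) s Q ↔ Q (s.setReg d (s.mem (s.reg a))) 1 :=
  ⟨fun ⟨_, _, h, hq⟩ => by cases h; exact hq, fun h => ⟨_, _, .load s d a, h⟩⟩

theorem wp_store {a b : ℕ} : WP (.store a b) s Q ↔ Q (s.setMem (s.reg a) (s.reg b)) 1 :=
  ⟨fun ⟨_, _, h, hq⟩ => by cases h; exact hq, fun h => ⟨_, _, .store s a b, h⟩⟩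

theorem wp_seq {p q : Prog} :
    WP (.seq p q) s Q ↔ WP p s fun s₁ t₁ => WP q s₁ fun s₂ t₂ => Q s₂ (t₁ + t₂) :=
  ⟨fun ⟨_, _, h, hq⟩ => by
    cases h with
    | seq h₁ h₂ => exact ⟨_, _, h₁, _, _, h₂, hq⟩,
   fun ⟨_, _, h₁, _, _, h₂, hq⟩ => ⟨_, _, .seq h₁ h₂, hq⟩⟩

theorem wp_cond {a : ℕ} {p q : Prog} :
    WP (.cond a p q) s Q ↔
      if s.reg a = 0 then WP q s fun s' t => Q s' (t + 1) else WP p s fun s' t => Q s' (t + 1) := by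
  constructor
  · rintro ⟨_, _, h, hq⟩
    cases h with
    | cond_true h0 h => rw [if_neg h0]; exact ⟨_, _, h, hq⟩
    | cond_false h0 h => rw [if_pos h0]; exact ⟨_, _, h, hq⟩
  · split_ifs with h0
    · rintro ⟨_, _, h, hq⟩; exact ⟨_, _, .cond_false h0 h, hq⟩
    · rintro ⟨_, _, h, hq⟩; exact ⟨_, _, .cond_true h0 h, hq⟩

/-- A loop whose control register counts down from `n` while an invariant is carried along. -/
theorem wp_loop {a n : ℕ} {p : Prog} (I : ℕ → State → Prop) (B : ℕ)
    (hreg : ∀ i s, i ≤ n → I i s → s.reg a = n - i)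
    (hbody : ∀ i s, i < n → I i s → WP p s fun s' t => I (i + 1) s' ∧ t ≤ B)
    (h0 : I 0 s) :
    WP (.loop a p) s fun s' t => I n s' ∧ t ≤ n * (B + 1) + 1 := by
  suffices H : ∀ r i s, i + r = n → I i s →
      WP (.loop a p) s fun s' t => I n s' ∧ t ≤ r * (B + 1) + 1 from
    H n 0 s (by omega) h0
  intro r
  induction r with
  | zero =>
    intro i s hi hI
    have : i = n := by omega
    subst this
    exact ⟨s, 1, .loop_done (by rw [hreg i s le_rfl hI]; omega), hI, by omega⟩
  | succ r ih =>
    intro i s hi hI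
    obtain ⟨s₁, t₁, e₁, hI₁, ht₁⟩ := hbody i s (by omega) hI
    obtain ⟨s₂, t₂, e₂, hI₂, ht₂⟩ := ih (i + 1) s₁ (by omega) hI₁
    refine ⟨s₂, t₁ + t₂ + 1, .loop_step ?_ e₁ e₂, hI₂, ?_⟩
    · rw [hreg i s (by omega) hI]; omega
    · rw [Nat.succ_mul]; omega

end Rules

@[simp] theorem reg_setReg (s : State) (d n r : ℕ) :
    (s.setReg d n).reg r = if r = d then n else s.reg r := by
  simp [State.setReg, Function.update_apply]

@[simp] theorem mem_setReg (s : State) (d n : ℕ) : (s.setReg d n).mem = s.mem := rfl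

@[simp] theorem reg_setMem (s : State) (x n : ℕ) : (s.setMem x n).reg = s.reg := rfl

@[simp] theorem mem_setMem (s : State) (x n y : ℕ) :
    (s.setMem x n).mem y = if y = x then n else s.mem y := by
  simp [State.setMem, Function.update_apply]

/-! ### Subroutines: shifting, halving and table updates -/

/-- Sequential composition of a list of programs. -/
def block : List Prog → Prog
  | [] => .skip
  | [p] => p
  | p :: q :: l => .seq p (block (q :: l))

/-- Multiply register `r` by two to the power of register `c`. Register `3` holds `0`, register `4`
holds `1`. -/
def shiftReg (r c : ℕ) : Prog :=
  block [.add 50 c 3, .loop 50 (block [.add r r r, .sub 50 50 4])]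

theorem wp_shiftReg {s : State} {r c : ℕ} (h3 : s.reg 3 = 0) (h4 : s.reg 4 = 1) (hr : r ≠ 50)
    (hr4 : r ≠ 4) :
    WP (shiftReg r c) s fun s' t =>
      (s'.reg r = s.reg r * 2 ^ s.reg c ∧ (∀ x, x ≠ r → x < 50 → s'.reg x = s.reg x) ∧
        s'.mem = s.mem) ∧ t ≤ 3 * s.reg c + 2 := by
  simp only [shiftReg, block, wp_seq, wp_add]
  refine (wp_loop (n := s.reg c) (fun i s' => s'.reg 50 = s.reg c - i ∧
    s'.reg r = s.reg r * 2 ^ i ∧ (∀ x, x ≠ r → x < 50 → s'.reg x = s.reg x) ∧ s'.mem = s.mem) 2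
    ?_ ?_ ?_).mono ?_
  · exact fun i s' _ h => h.1
  · rintro i s' hi ⟨h1, h2, h5, h6⟩
    simp only [wp_seq, wp_add, wp_sub]
    have h4' : s'.reg 4 = 1 := by rw [h5 4 (by omega) (by omega), h4]
    refine ⟨⟨?_, ?_, ?_, ?_⟩, by omega⟩
    · simp [hr.symm, hr4.symm, h1, h4']; omega
    · simp [hr, h2, pow_succ]; ring
    · intro x hx hx'
      simp [hx, hx'.ne, h5 x hx hx']
    · simpa using h6
  · refine ⟨by simp [h3], by simp [hr], ?_, rfl⟩
    intro x hx hx'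
    simp [hx'.ne]
  · rintro s' t ⟨⟨h1, h2, h5, h6⟩, ht⟩
    exact ⟨⟨h2, h5, h6⟩, by omega⟩

/-- Put half of register `16`, rounded up, into register `15`. Register `25` holds `2`. -/
def halfUp : Prog :=
  block [.const 15 0, .loop 16 (block [.add 15 15 4, .sub 16 16 25])]

/-- The counter drops by two, so `wp_loop` does not fit and strong induction is used. Truncated
subtraction turns a counter `1` into `0` at the cost of one more round, which is the rounding up. -/
theorem wp_halfUp {s : State} (h4 : s.reg 4 = 1) (h25 : s.reg 25 = 2) :
    WP halfUp s fun s' t =>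
      (s'.reg 15 = (s.reg 16 + 1) / 2 ∧ (∀ x, x ≠ 15 → x ≠ 16 → s'.reg x = s.reg x) ∧
        s'.mem = s.mem) ∧ t ≤ 3 * s.reg 16 + 2 := by
  simp only [halfUp, block, wp_seq, wp_const]
  suffices H : ∀ n s, s.reg 4 = 1 → s.reg 25 = 2 → s.reg 16 = n →
      WP (.loop 16 (.seq (.add 15 15 4) (.sub 16 16 25))) s fun s' t =>
      (s'.reg 15 = s.reg 15 + (n + 1) / 2 ∧ (∀ x, x ≠ 15 → x ≠ 16 → s'.reg x = s.reg x) ∧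
        s'.mem = s.mem) ∧ t ≤ 3 * n + 1 by
    refine (H (s.reg 16) _ (by simpa using h4) (by simpa using h25) (by simp)).mono ?_
    rintro s' t ⟨⟨h1, h2, h5⟩, ht⟩
    refine ⟨⟨by simpa using h1, fun x hx hx' => ?_, by simpa using h5⟩, by omega⟩
    simpa [hx] using h2 x hx hx'
  intro n
  induction n using Nat.strong_induction_on with
  | _ n ih =>
  intro s h4 h25 h16
  rcases Nat.eq_zero_or_pos n with h0 | h0
  · exact ⟨s, 1, .loop_done (by omega), ⟨by simp [h0], fun _ _ _ => rfl, rfl⟩, by omega⟩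
  · obtain ⟨s₂, t₂, e₂, ⟨h1, h2, h5⟩, ht⟩ := ih (n - 2) (by omega)
      ((s.setReg 15 (s.reg 15 + s.reg 4)).setReg 16 (s.reg 16 - s.reg 25))
      (by simpa using h4) (by simpa using h25) (by simp [h16, h25])
    refine ⟨s₂, _, .loop_step (by omega) (.seq (.add _ _ _ _) (.sub _ _ _ _)) (t₂ := t₂) ?_,
      ⟨?_, fun x hx hx' => ?_, ?_⟩, ?_⟩
    · simpa using e₂
    · simp [h4] at h1; omega
    · simpa [hx, hx'] using h2 x hx hx'
    · simpa using h5
    · omega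

/-- The table update for one more item with code `Z` and weight `W`; an entry `0` means that the
index is unreachable. -/
def addItem (W Z : ℕ) (T : ℕ → ℕ) (c : ℕ) : ℕ :=
  if Z ≤ c ∧ T (c - Z) ≠ 0 then max (T c) (T (c - Z) + W) else T c

/-- One item: the table has base address in register `9` and length in register `7`, the code is in
register `21` and the weight in register `13`. -/
def addItemProg : Prog :=
  block [.add 40 7 3, .loop 40 (block [
    .sub 40 40 4,
    .sub 41 21 40,
    .cond 41 .skip (block [
      .sub 41 40 21,
      .add 41 41 9,
      .load 42 41,
      .cond 42 (block [
        .add 42 42 13,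
        .add 43 40 9,
        .load 44 43,
        .sub 42 42 44,
        .add 44 44 42,
        .store 43 44]) .skip])])]

/-- The indices run downwards, so the entry at `c - Z` is still the old one when `c` is updated, and
the item is used at most once. For `Z = 0` both are the same cell, which is read before it is
written. The maximum of two numbers is formed as `x + (y - x)`. -/
theorem wp_addItemProg {s : State} (h3 : s.reg 3 = 0) (h4 : s.reg 4 = 1) :
    WP addItemProg s fun s' t =>
      ((∀ c < s.reg 7, s'.mem (s.reg 9 + c) =
          addItem (s.reg 13) (s.reg 21) (fun x => s.mem (s.reg 9 + x)) c) ∧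
        (∀ x, x < s.reg 9 ∨ s.reg 9 + s.reg 7 ≤ x → s'.mem x = s.mem x) ∧
        (∀ x < 40, s'.reg x = s.reg x)) ∧ t ≤ 16 * s.reg 7 + 2 := by
  obtain ⟨N, hN⟩ : ∃ N, N = s.reg 7 := ⟨_, rfl⟩
  obtain ⟨a, ha⟩ : ∃ a, a = s.reg 9 := ⟨_, rfl⟩
  obtain ⟨Z, hZ⟩ : ∃ Z, Z = s.reg 21 := ⟨_, rfl⟩
  obtain ⟨W, hW⟩ : ∃ W, W = s.reg 13 := ⟨_, rfl⟩
  rw [← hN, ← ha, ← hZ, ← hW]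
  simp only [addItemProg, block, wp_seq, wp_add]
  refine (wp_loop (n := N) (fun i s' => s'.reg 40 = N - i ∧ (∀ x < 40, s'.reg x = s.reg x) ∧
      (∀ x, x < a ∨ a + N ≤ x → s'.mem x = s.mem x) ∧
      (∀ c < N, s'.mem (a + c) = if c + i < N then s.mem (a + c) else
        addItem W Z (fun x => s.mem (a + x)) c)) 15 ?_ ?_ ?_).mono ?_
  · exact fun i s' _ h => h.1
  · rintro i s' hi ⟨h1, h2, h5, h6⟩
    have r4 : s'.reg 4 = 1 := by rw [h2 4 (by omega), h4]
    have r9 : s'.reg 9 = a := by rw [h2 9 (by omega), ha]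
    have r13 : s'.reg 13 = W := by rw [h2 13 (by omega), hW]
    have r21 : s'.reg 21 = Z := by rw [h2 21 (by omega), hZ]
    obtain ⟨n, hn⟩ : ∃ n, N - i = n + 1 := ⟨N - i - 1, by omega⟩
    have hc := h6 n (by omega)
    rw [if_pos (by omega)] at hc
    simp only [wp_seq, wp_sub, wp_cond, wp_skip, wp_add, wp_load, wp_store]
    simp only [reg_setReg, mem_setReg, reg_setMem, h1, r4, r9, r13, r21, hn, reduceIte,
      Nat.reduceEqDiff, Nat.add_sub_cancel]
    split_ifs with hz hv
    · have e : s'.mem (n - Z + a) = s.mem (a + (n - Z)) := by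
        rw [add_comm (n - Z), h6 _ (by omega), if_pos (by omega)]
      rw [e] at hv
      refine ⟨⟨by omega, ?_, h5, ?_⟩, by omega⟩
      · intro x hx
        have : x ≠ 40 ∧ x ≠ 41 ∧ x ≠ 42 := by omega
        simp [this, h2 x hx]
      · intro c hcN
        simp only [h6 c hcN]
        by_cases hcn : c = n
        · subst hcn
          rw [if_pos (by omega), if_neg (by omega), addItem, if_neg (by simp [hv])]
        · split_ifs <;> first | rfl | omega
    · have e : s'.mem (n - Z + a) = s.mem (a + (n - Z)) := by
        rw [add_comm (n - Z), h6 _ (by omega), if_pos (by omega)]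
      rw [e] at hv
      refine ⟨⟨by omega, ?_, ?_, ?_⟩, by omega⟩
      · intro x hx
        have : x ≠ 40 ∧ x ≠ 41 ∧ x ≠ 42 ∧ x ≠ 43 ∧ x ≠ 44 := by omega
        simp [this, h2 x hx]
      · intro x hx
        rw [mem_setMem, if_neg (by omega)]
        exact h5 x hx
      · intro c hcN
        rw [mem_setMem]
        by_cases hcn : c = n
        · subst hcn
          rw [if_pos (by omega), if_neg (by omega), addItem, if_pos ⟨by omega, hv⟩, e,
            add_comm c a, hc]
          omega
        · rw [if_neg (by omega)]
          simp only [mem_setReg, h6 c hcN]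
          split_ifs <;> first | rfl | omega
    · refine ⟨⟨by omega, ?_, h5, ?_⟩, by omega⟩
      · intro x hx
        have : x ≠ 40 ∧ x ≠ 41 := by omega
        simp [this, h2 x hx]
      · intro c hcN
        simp only [h6 c hcN]
        by_cases hcn : c = n
        · subst hcn
          rw [if_pos (by omega), if_neg (by omega), addItem, if_neg (by omega)]
        · split_ifs <;> first | rfl | omega
  · refine ⟨by simp [h3, hN], fun x hx => by simp [hx.ne], by simp, fun c hc => ?_⟩
    rw [if_pos (by omega)]; rfl
  · rintro s' t ⟨⟨h1, h2, h5, h6⟩, ht⟩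
    refine ⟨⟨fun c hc => ?_, h5, h2⟩, by omega⟩
    rw [h6 c hc, if_neg (by omega)]

/-- Push a table forward along `g`, keeping the largest entry in every cell. -/
def pushTable (N : ℕ) (g T : ℕ → ℕ) (c : ℕ) : ℕ :=
  (Finset.range N).sup fun x => if g x = c then T x else 0

/-- Push the table at base address `reg 9` forward, in place, along the map that is stored
from address `reg 11 + reg 17` on. -/
def pushProg : Prog :=
  block [.add 20 7 3, .loop 20 (block [
    .sub 21 7 20,
    .add 22 9 21,
    .load 23 22,
    .cond 23 (block [
      .store 22 3,
      .add 24 21 17,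
      .add 24 24 11,
      .load 24 24,
      .add 24 24 9,
      .load 26 24,
      .sub 27 23 26,
      .add 26 26 27,
      .store 24 26]) .skip,
    .sub 20 20 4])]

/-- The indices run upwards. As `g c ≤ c`, an entry moves to its own cell or to a cell already
processed, so no unread entry is overwritten. The inequality is needed only for occupied cells,
since other indices need not code a reached vector. -/
theorem wp_pushProg {s : State} {g : ℕ → ℕ} (h3 : s.reg 3 = 0) (h4 : s.reg 4 = 1)
    (hb : s.reg 9 + s.reg 7 ≤ s.reg 11)
    (hg : ∀ c < s.reg 7, s.mem (c + s.reg 17 + s.reg 11) = g c)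
    (hle : ∀ c < s.reg 7, s.mem (s.reg 9 + c) ≠ 0 → g c ≤ c) :
    WP pushProg s fun s' t =>
      ((∀ c < s.reg 7, s'.mem (s.reg 9 + c) =
          pushTable (s.reg 7) g (fun x => s.mem (s.reg 9 + x)) c) ∧
        (∀ x, x < s.reg 9 ∨ s.reg 9 + s.reg 7 ≤ x → s'.mem x = s.mem x) ∧
        (∀ x < 20, s'.reg x = s.reg x) ∧ s'.reg 25 = s.reg 25) ∧ t ≤ 16 * s.reg 7 + 2 := by
  obtain ⟨N, hN⟩ : ∃ N, N = s.reg 7 := ⟨_, rfl⟩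
  obtain ⟨a, ha⟩ : ∃ a, a = s.reg 9 := ⟨_, rfl⟩
  obtain ⟨d, hd⟩ : ∃ d, d = s.reg 11 := ⟨_, rfl⟩
  obtain ⟨o, ho⟩ : ∃ o, o = s.reg 17 := ⟨_, rfl⟩
  rw [← hN, ← ha, ← hd] at hb
  rw [← hN, ← ha] at hle
  rw [← hN, ← ho, ← hd] at hg
  rw [← hN, ← ha]
  simp only [pushProg, block, wp_seq, wp_add]
  refine (wp_loop (n := N) (fun i s' => s'.reg 20 = N - i ∧
      ((∀ x < 20, s'.reg x = s.reg x) ∧ s'.reg 25 = s.reg 25) ∧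
      (∀ x, x < a ∨ a + N ≤ x → s'.mem x = s.mem x) ∧
      (∀ c < N, s'.mem (a + c) = if c < i then pushTable i g (fun x => s.mem (a + x)) c else
        s.mem (a + c))) 15 ?_ ?_ ?_).mono ?_
  · exact fun i s' _ h => h.1
  · rintro i s' hi ⟨h1, ⟨h2, h25⟩, h5, h6⟩
    have r3 : s'.reg 3 = 0 := by rw [h2 3 (by omega), h3]
    have r4 : s'.reg 4 = 1 := by rw [h2 4 (by omega), h4]
    have r7 : s'.reg 7 = N := by rw [h2 7 (by omega), hN]
    have r9 : s'.reg 9 = a := by rw [h2 9 (by omega), ha]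
    have r11 : s'.reg 11 = d := by rw [h2 11 (by omega), hd]
    have r17 : s'.reg 17 = o := by rw [h2 17 (by omega), ho]
    have hc := h6 i hi
    rw [if_neg (by omega)] at hc
    have hsub : N - (N - i) = i := by omega
    have hH := h5 (i + o + d) (by omega)
    rw [hg i hi] at hH
    have hlei := hle i hi
    have hsup : ∀ c, pushTable (i + 1) g (fun x => s.mem (a + x)) c =
        max (if g i = c then s.mem (a + i) else 0) (pushTable i g (fun x => s.mem (a + x)) c) := by
      intro c
      rw [pushTable, Finset.range_add_one, Finset.sup_insert]
      rfl
    -- Nothing from an earlier cell lands in cell `i`: an occupied `x < i` has `g x ≤ x < i`.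
    -- Clearing cell `i` is therefore correct before its own entry is placed.
    have hself : pushTable i g (fun x => s.mem (a + x)) i = 0 := by
      refine Nat.le_zero.1 (Finset.sup_le fun x hx => ?_)
      have hx' := Finset.mem_range.1 hx
      split_ifs with h
      · by_contra hne
        dsimp only at hne
        have := hle x (by omega) (by omega)
        omega
      · exact le_rfl
    simp only [wp_seq, wp_sub, wp_cond, wp_skip, wp_add, wp_load, wp_store]
    simp only [reg_setReg, mem_setReg, reg_setMem, h1, r3, r4, r7, r9, r11, r17, reduceIte,
      Nat.reduceEqDiff, hsub, hc]
    split_ifs with hv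
    · refine ⟨⟨by omega, ⟨?_, ?_⟩, h5, ?_⟩, by omega⟩
      · intro x hx
        have : x ≠ 20 ∧ x ≠ 21 ∧ x ≠ 22 ∧ x ≠ 23 := by omega
        simp [this, h2 x hx]
      · exact h25
      · intro c hcN
        simp only [h6 c hcN, hsup, hv, ite_self]
        by_cases hcn : c = i
        · subst hcn
          rw [if_neg (by omega), if_pos (by omega), hself, hv]
          rfl
        · split_ifs <;> omega
    · have hgi := hlei hv
      have e1 : (s'.setMem (a + i) 0).mem (i + o + d) = g i := by
        rw [mem_setMem, if_neg (by omega), hH]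
      refine ⟨⟨by omega, ⟨?_, ?_⟩, ?_, ?_⟩, by omega⟩
      · intro x hx
        have : x ≠ 20 ∧ x ≠ 21 ∧ x ≠ 22 ∧ x ≠ 23 ∧ x ≠ 24 ∧ x ≠ 26 ∧ x ≠ 27 := by omega
        simp [this, h2 x hx]
      · exact h25
      · intro x hx
        simp only [mem_setMem, mem_setReg]
        rw [if_neg (show ¬ i + o + d = a + i by omega), hH, if_neg (by omega), if_neg (by omega)]
        exact h5 x hx
      · intro c hcN
        simp only [mem_setMem, mem_setReg]
        rw [if_neg (show ¬ i + o + d = a + i by omega), hH, hsup, h6 c hcN, add_comm (g i) a]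
        have e2 := h6 (g i) (by omega)
        rw [e2]
        by_cases hci : c = i
        · subst hci
          rw [hself]
          split_ifs <;> omega
        · by_cases hcg : c = g i
          · subst hcg
            split_ifs <;> omega
          · split_ifs <;> omega
  · refine ⟨by simp [h3, hN], ⟨fun x hx => by simp [hx.ne], by simp⟩, by simp, fun c hc => ?_⟩
    rw [if_neg (by omega)]; rfl
  · rintro s' t ⟨⟨h1, ⟨h2, h25⟩, h5, h6⟩, ht⟩
    refine ⟨⟨fun c hc => ?_, h5, h2, h25⟩, by omega⟩
    rw [h6 c hc, if_pos (by omega)]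

/-- For every code `Z`, with multiplicity `u` in the table at base address `reg 10`, use
`u - 2 * ((u - 1) / 2)` items of code `Z` and leave the multiplicity `(u - 1) / 2`. -/
def itemsProg : Prog :=
  block [.add 20 7 3, .loop 20 (block [
    .sub 21 7 20,
    .add 22 10 21,
    .load 23 22,
    .sub 16 23 25,
    halfUp,
    .store 22 15,
    .add 15 15 15,
    .sub 30 23 15,
    .loop 30 (block [addItemProg, .sub 30 30 4]),
    .sub 20 20 4])]

/-- The number of single items that are split off from a pile of size `u`. -/
def odds (u : ℕ) : ℕ := u - 2 * ((u - 1) / 2)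

theorem odds_le (u : ℕ) : odds u ≤ 2 := by unfold odds; omega

/-- The relation `Φ` between the items used so far and the table is left abstract, which separates
the memory bookkeeping from the meaning of the table. It only has to survive one knapsack update and
to depend on the table cells alone. -/
theorem wp_itemsProg {s : State} {w : ℕ} (h3 : s.reg 3 = 0) (h4 : s.reg 4 = 1) (h25 : s.reg 25 = 2)
    (hb : s.reg 9 + s.reg 7 ≤ s.reg 10) (U : ℕ → ℕ) (hU : ∀ c < s.reg 7, s.mem (s.reg 10 + c) = U c)
    (hU0 : ∀ c, s.reg 7 ≤ c → U c = 0) (hUw : ∀ c, U c ≤ w)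
    (Φ : (ℕ → ℕ) → (ℕ → ℕ) → Prop)
    (hΦ : ∀ P Z T T', (∀ x, P x ≤ odds (U x)) → P Z < odds (U Z) → Z < s.reg 7 → Φ P T →
      (∀ c < s.reg 7, T' c = addItem (s.reg 13) Z T c) → Φ (Function.update P Z (P Z + 1)) T')
    (hcongr : ∀ P T T', (∀ c < s.reg 7, T' c = T c) → Φ P T → Φ P T')
    (h0 : Φ (fun _ => 0) fun x => s.mem (s.reg 9 + x)) :
    WP itemsProg s fun s' t =>
      ((Φ (fun x => odds (U x)) fun x => s'.mem (s.reg 9 + x)) ∧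
        (∀ c < s.reg 7, s'.mem (s.reg 10 + c) = (U c - 1) / 2) ∧
        (∀ x, x < s.reg 9 ∨ s.reg 10 + s.reg 7 ≤ x → s'.mem x = s.mem x) ∧
        (∀ x < 15, s'.reg x = s.reg x) ∧ s'.reg 25 = s.reg 25) ∧
      t ≤ s.reg 7 * (3 * w + 32 * s.reg 7 + 50) + 2 := by
  obtain ⟨N, hN⟩ : ∃ N, N = s.reg 7 := ⟨_, rfl⟩
  obtain ⟨a, ha⟩ : ∃ a, a = s.reg 9 := ⟨_, rfl⟩
  obtain ⟨d, hd⟩ : ∃ d, d = s.reg 10 := ⟨_, rfl⟩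
  obtain ⟨W, hW⟩ : ∃ W, W = s.reg 13 := ⟨_, rfl⟩
  rw [← hN, ← ha, ← hd] at hb
  rw [← ha] at h0
  rw [← hN, ← hd] at hU
  rw [← hN] at hU0
  rw [← hN, ← hW] at hΦ
  rw [← hN] at hcongr
  rw [← hN, ← ha, ← hd]
  simp only [itemsProg, block, wp_seq, wp_add]
  refine (wp_loop (n := N) (fun i s' => s'.reg 20 = N - i ∧
      ((∀ x < 15, s'.reg x = s.reg x) ∧ s'.reg 25 = s.reg 25) ∧
      (∀ x, x < a ∨ d + N ≤ x → s'.mem x = s.mem x) ∧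
      (∀ c < N, s'.mem (d + c) = if c < i then (U c - 1) / 2 else U c) ∧
      Φ (fun x => if x < i then odds (U x) else 0) (fun x => s'.mem (a + x)))
      (3 * w + 32 * N + 40) ?_ ?_ ?_).mono ?_
  · exact fun i s' _ h => h.1
  · rintro i s' hi ⟨h1, ⟨h2, h25'⟩, h5, h6, h7⟩
    have r3 : s'.reg 3 = 0 := by rw [h2 3 (by omega), h3]
    have r4 : s'.reg 4 = 1 := by rw [h2 4 (by omega), h4]
    have r7 : s'.reg 7 = N := by rw [h2 7 (by omega), hN]
    have r9 : s'.reg 9 = a := by rw [h2 9 (by omega), ha]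
    have r10 : s'.reg 10 = d := by rw [h2 10 (by omega), hd]
    have hc := h6 i hi
    rw [if_neg (by omega)] at hc
    have hsub : N - (N - i) = i := by omega
    rw [h25] at h25'
    simp only [wp_seq, wp_sub, wp_add, wp_load]
    simp only [reg_setReg, mem_setReg, h1, r7, r10, h25', reduceIte,
      Nat.reduceEqDiff, hsub, hc]
    refine (wp_halfUp (by simpa using r4) (by simpa using h25')).mono ?_
    rintro s₁ t₁ ⟨⟨a1, a2, a5⟩, at1⟩
    have a4 : s₁.reg 4 = 1 := by simpa [r4] using a2 4 (by omega) (by omega)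
    have a22 : s₁.reg 22 = d + i := by simpa using a2 22 (by omega) (by omega)
    have a23 : s₁.reg 23 = U i := by simpa using a2 23 (by omega) (by omega)
    have a20 : s₁.reg 20 = N - i := by simpa [h1] using a2 20 (by omega) (by omega)
    have a21 : s₁.reg 21 = i := by simpa using a2 21 (by omega) (by omega)
    have a25 : s₁.reg 25 = 2 := by simpa [h25'] using a2 25 (by omega) (by omega)
    have a15 : ∀ x < 15, s₁.reg x = s.reg x := by
      intro x hx
      rw [a2 x (by omega) (by omega), ← h2 x hx]
      have : x ≠ 16 ∧ x ≠ 21 ∧ x ≠ 22 ∧ x ≠ 23 := by omega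
      simp [this]
    simp only [reg_setReg, mem_setReg, reduceIte] at a1 a5 at1
    -- `halfUp` was applied to `U i - 2`. With truncated subtraction `(U i - 2 + 1) / 2 = (U i - 1)
    -- / 2` holds for `U i = 0` and `U i = 1` as well.
    have a1' : s₁.reg 15 = (U i - 1) / 2 := by omega
    simp only [wp_store]
    simp only [reg_setMem, a1', a22, a23]
    have hodd : U i - ((U i - 1) / 2 + (U i - 1) / 2) = odds (U i) := by unfold odds; omega
    rw [hodd]
    refine WP.mono (wp_loop (n := odds (U i)) (fun j s' => s'.reg 30 = odds (U i) - j ∧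
      ((∀ x < 15, s'.reg x = s.reg x) ∧ s'.reg 25 = 2 ∧ s'.reg 20 = N - i ∧ s'.reg 21 = i) ∧
      (∀ x, x < a ∨ d + N ≤ x → s'.mem x = s.mem x) ∧
      (∀ c < N, s'.mem (d + c) = if c < i + 1 then (U c - 1) / 2 else U c) ∧
      Φ (fun x => if x < i then odds (U x) else if x = i then j else 0) (fun x => s'.mem (a + x)))
      (16 * N + 3) ?_ ?_ ?_) ?_
    · exact fun i s' _ h => h.1
    · rintro j s₂ hj ⟨b1, ⟨b2, b25, b20, b21⟩, b5, b6, b7⟩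
      simp only [wp_seq, wp_sub]
      refine (wp_addItemProg (by rw [b2 3 (by omega), h3]) (by rw [b2 4 (by omega), h4])).mono ?_
      rw [b2 7 (by omega), b2 9 (by omega), b2 13 (by omega), b21, ← hN, ← ha, ← hW]
      rintro s₃ t₃ ⟨⟨c1, c2, c5⟩, ct⟩
      refine ⟨⟨?_, ⟨?_, ?_, ?_, ?_⟩, ?_, ?_, ?_⟩, by omega⟩
      · simp [c5, b1, b2 4 (by omega), h4]; omega
      · intro x hx
        rw [reg_setReg, if_neg (by omega), c5 x (by omega), b2 x hx]
      · simp [c5, b25]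
      · simp [c5, b20]
      · simp [c5, b21]
      · intro x hx
        rw [mem_setReg, c2 x (by omega), b5 x hx]
      · intro c hc
        rw [mem_setReg, c2 _ (by omega), b6 c hc]
      · have := hΦ _ i _ (fun x => s₃.mem (a + x)) ?_ ?_ hi b7 (fun c hc => ?_)
        · simp only [mem_setReg]
          convert this using 1
          funext x
          simp only [Function.update_apply, lt_irrefl, if_false, if_true]
          split_ifs <;> omega
        · intro x
          split_ifs with h h'
          · exact le_rfl
          · subst h'; omega
          · omega
        · simpa using hj
        · exact c1 c hc
    · refine ⟨by simp, ⟨?_, ?_, ?_, ?_⟩, ?_, ?_, ?_⟩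
      · intro x hx
        have : x ≠ 15 ∧ x ≠ 30 := by omega
        simp [this, a15 x hx]
      · simpa using a25
      · simpa using a20
      · simpa using a21
      · intro x hx
        simp only [mem_setReg, mem_setMem, a5]
        rw [if_neg (by omega), h5 x hx]
      · intro c hc
        simp only [mem_setReg, mem_setMem, a5, h6 c hc]
        split_ifs <;> first | rfl | omega | (have : c = i := by omega
                                             subst this; rfl)
      · have e : (fun x => if x < i then odds (U x) else if x = i then 0 else 0) =
            fun x => if x < i then odds (U x) else 0 := by simp
        rw [e]
        refine hcongr _ _ _ (fun c hc => ?_) h7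
        simp only [mem_setReg, mem_setMem, a5]
        rw [if_neg (by omega)]
    · rintro s₂ t₂ ⟨⟨b1, ⟨b2, b25, b20, b21⟩, b5, b6, b7⟩, bt⟩
      refine ⟨⟨?_, ⟨?_, ?_⟩, ?_, ?_, ?_⟩, ?_⟩
      · simp [b20, b2 4 (by omega), h4]; omega
      · intro x hx
        rw [if_neg (by omega), b2 x hx]
      · simpa [h25] using b25
      · simpa using b5
      · simpa using b6
      · convert b7 using 1
        funext x
        split_ifs <;> first | rfl | omega | (have : x = i := by omega
                                             subst this; rfl)
      · have h2' := odds_le (U i)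
        have := hUw i
        have h3 : odds (U i) * (16 * N + 3 + 1) ≤ 2 * (16 * N + 3 + 1) :=
          Nat.mul_le_mul_right _ h2'
        omega
  · refine ⟨by simp [h3, hN], ⟨fun x hx => ?_, by simp⟩, by simp, fun c hc => ?_, ?_⟩
    · have : x ≠ 20 := by omega
      simp [this]
    · simpa using hU c hc
    · simpa using h0
  · rintro s' t ⟨⟨h1, ⟨h2, h25⟩, h5, h6, h7⟩, ht⟩
    refine ⟨⟨?_, fun c hc => ?_, h5, h2, h25⟩, ?_⟩
    · convert h7 using 1
      funext x
      split_ifs with h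
      · rfl
      · rw [hU0 x (by omega)]; rfl
    · rw [h6 c hc, if_pos hc]
    · have : N * (3 * w + 32 * N + 40 + 1) ≤ N * (3 * w + 32 * N + 50) :=
        Nat.mul_le_mul_left _ (by omega)
      omega

/-! ### Vectors as numbers -/

/-- The number whose base `K` digits, the most significant one first, are the first `n` entries
of `v`. -/
def enc (K : ℕ) (v : ℕ → ℕ) : ℕ → ℕ
  | 0 => 0
  | n + 1 => K * enc K v n + v n

theorem enc_add (K : ℕ) (v v' : ℕ → ℕ) (n : ℕ) :
    enc K (fun j => v j + v' j) n = enc K v n + enc K v' n := by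
  induction n with
  | zero => rfl
  | succ n ih => simp only [enc, ih]; ring

theorem enc_mono {K : ℕ} {v v' : ℕ → ℕ} {n : ℕ} (h : ∀ j < n, v j ≤ v' j) :
    enc K v n ≤ enc K v' n := by
  induction n with
  | zero => exact le_rfl
  | succ n ih =>
    exact Nat.add_le_add (Nat.mul_le_mul_left _ (ih fun j hj => h j (by omega))) (h n (by omega))

theorem enc_lt {K : ℕ} {v : ℕ → ℕ} {n : ℕ} (h : ∀ j < n, v j < K) : enc K v n < K ^ n := by
  induction n with
  | zero => simp [enc]
  | succ n ih =>
    have h1 := ih fun j hj => h j (by omega)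
    have h2 := h n (by omega)
    have h3 : K * (enc K v n + 1) ≤ K * K ^ n := Nat.mul_le_mul_left _ h1
    rw [enc, pow_succ']
    rw [mul_add] at h3
    omega

theorem enc_eq_zero {K : ℕ} {v : ℕ → ℕ} {n : ℕ} (hK : 0 < K) :
    enc K v n = 0 ↔ ∀ j < n, v j = 0 := by
  induction n with
  | zero => simp [enc]
  | succ n ih =>
    simp only [enc, Nat.add_eq_zero_iff, Nat.mul_eq_zero, hK.ne', false_or, ih]
    constructor
    · rintro ⟨h1, h2⟩ j hj
      rcases Nat.lt_succ_iff_lt_or_eq.1 hj with h | rfl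
      · exact h1 j h
      · exact h2
    · exact fun h => ⟨fun j hj => h j (by omega), h n (by omega)⟩

theorem enc_inj {K : ℕ} {v v' : ℕ → ℕ} {n : ℕ} (h : ∀ j < n, v j < K) (h' : ∀ j < n, v' j < K)
    (he : enc K v n = enc K v' n) : ∀ j < n, v j = v' j := by
  induction n with
  | zero => intro j hj; omega
  | succ n ih =>
    have hn := h n (by omega)
    have hn' := h' n (by omega)
    simp only [enc] at he
    have hd := congrArg (· / K) he
    have hm := congrArg (· % K) he
    simp only [Nat.mul_add_div (show 0 < K by omega), Nat.mul_add_mod, Nat.div_eq_of_lt hn,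
      Nat.div_eq_of_lt hn', Nat.mod_eq_of_lt hn, Nat.mod_eq_of_lt hn', add_zero] at hd hm
    intro j hj
    rcases Nat.lt_succ_iff_lt_or_eq.1 hj with hj | rfl
    · exact ih (fun j hj => h j (by omega)) (fun j hj => h' j (by omega)) hd j hj
    · exact hm

/-- The recursion assumed for `h` is the one by which the lookup table is filled; it is unwound
digit by digit, `r` being the code of a prefix of `v`. -/
theorem half_enc {K m : ℕ} {h v : ℕ → ℕ} (h0 : h 0 = 0)
    (hh : ∀ r < K ^ m, ∀ d < K, h (K * r + d) = K * h r + d / 2) (hv : ∀ j < m, v j < K) :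
    h (enc K v m) = enc K (fun j => v j / 2) m := by
  suffices H : ∀ n ≤ m, h (enc K v n) = enc K (fun j => v j / 2) n from H m le_rfl
  intro n
  induction n with
  | zero => exact fun _ => h0
  | succ n ih =>
    intro hn
    have hlt : enc K v n < K ^ n := enc_lt fun j hj => hv j (by omega)
    have hK : 0 < K := by have := hv n (by omega); omega
    have : K ^ n ≤ K ^ m := Nat.pow_le_pow_right hK (by omega)
    rw [enc, hh _ (by omega) _ (hv n (by omega)), ih (by omega), enc]

/-! ### Tables of best values -/

/-- The table `T` holds, for every vector code `c`, one more than the largest value that occurs in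
`R` with a vector of code `c`, and `0` if there is none. -/
def Rep (K m : ℕ) (R : Set ((ℕ → ℕ) × ℕ)) (T : ℕ → ℕ) : Prop :=
  (∀ p ∈ R, enc K p.1 m < K ^ m ∧ p.2 < T (enc K p.1 m)) ∧
    ∀ c < K ^ m, T c ≠ 0 → ∃ p ∈ R, enc K p.1 m = c ∧ p.2 + 1 = T c

theorem Rep.congr {K m : ℕ} {R : Set ((ℕ → ℕ) × ℕ)} {T T' : ℕ → ℕ} (h : Rep K m R T)
    (hT : ∀ c < K ^ m, T' c = T c) : Rep K m R T' := by
  refine ⟨fun p hp => ?_, fun c hc h0 => ?_⟩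
  · obtain ⟨h1, h2⟩ := h.1 p hp
    exact ⟨h1, by rwa [hT _ h1]⟩
  · rw [hT c hc] at h0 ⊢
    exact h.2 c hc h0

/-- The best value with image code `c` is the maximum over all codes sent to `c`. A nonzero maximum
is attained at some code, and `Rep` supplies a pair there. -/
theorem Rep.push {K m : ℕ} {R : Set ((ℕ → ℕ) × ℕ)} {T T' g : ℕ → ℕ} (h : Rep K m R T)
    (f : (ℕ → ℕ) → (ℕ → ℕ)) (hf : ∀ p ∈ R, g (enc K p.1 m) = enc K (f p.1) m)
    (hlt : ∀ p ∈ R, enc K (f p.1) m < K ^ m)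
    (hT : ∀ c < K ^ m, T' c = pushTable (K ^ m) g T c) :
    Rep K m ((fun p => (f p.1, p.2)) '' R) T' := by
  constructor
  · rintro _ ⟨p, hp, rfl⟩
    refine ⟨hlt p hp, ?_⟩
    dsimp only
    rw [hT _ (hlt p hp), pushTable, Finset.lt_sup_iff]
    refine ⟨enc K p.1 m, Finset.mem_range.2 (h.1 p hp).1, ?_⟩
    rw [if_pos (hf p hp)]
    exact (h.1 p hp).2
  · intro c hc h0
    rw [hT c hc] at h0 ⊢
    have hN : (Finset.range (K ^ m)).Nonempty := ⟨c, Finset.mem_range.2 hc⟩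
    obtain ⟨x, hx, hmax⟩ := Finset.exists_mem_eq_sup (Finset.range (K ^ m)) hN
      (fun x => if g x = c then T x else 0)
    rw [pushTable, hmax] at h0 ⊢
    split_ifs at h0 ⊢ with hg
    · obtain ⟨p, hp, he, hv⟩ := h.2 x (Finset.mem_range.1 hx) h0
      exact ⟨_, ⟨p, hp, rfl⟩, by dsimp only; rw [← hf p hp, he, hg], hv⟩
    · exact absurd rfl h0

/-- What is reached from `R` by adding up to `P Z` times the vector `z Z` with weight `W`, for all
`Z < N`. -/
def Items (N : ℕ) (z : ℕ → ℕ → ℕ) (W : ℕ) (R : Set ((ℕ → ℕ) × ℕ)) (P : ℕ → ℕ) :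
    Set ((ℕ → ℕ) × ℕ) :=
  {q | ∃ p ∈ R, ∃ y : ℕ → ℕ, (∀ Z, y Z ≤ P Z) ∧
    q = (fun j => p.1 j + ∑ Z ∈ Finset.range N, y Z * z Z j,
      p.2 + W * ∑ Z ∈ Finset.range N, y Z)}

theorem Items_zero (N : ℕ) (z : ℕ → ℕ → ℕ) (W : ℕ) (R : Set ((ℕ → ℕ) × ℕ)) :
    Items N z W R (fun _ => 0) = R := by
  ext q
  constructor
  · rintro ⟨p, hp, y, hy, rfl⟩
    have : y = fun _ => 0 := funext fun Z => Nat.le_zero.1 (hy Z)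
    subst this
    simpa using hp
  · exact fun hq => ⟨q, hq, fun _ => 0, fun _ => le_rfl, by simp⟩

theorem Items_mono {N : ℕ} {z : ℕ → ℕ → ℕ} {W : ℕ} {R : Set ((ℕ → ℕ) × ℕ)} {P P' : ℕ → ℕ}
    (h : ∀ Z, P Z ≤ P' Z) : Items N z W R P ⊆ Items N z W R P' := by
  rintro q ⟨p, hp, y, hy, rfl⟩
  exact ⟨p, hp, y, fun Z => (hy Z).trans (h Z), rfl⟩

theorem sum_update_succ {N Z : ℕ} (hZ : Z < N) (y f : ℕ → ℕ) :
    ∑ x ∈ Finset.range N, Function.update y Z (y Z + 1) x * f x =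
      ∑ x ∈ Finset.range N, y x * f x + f Z := by
  rw [← Finset.add_sum_erase _ _ (Finset.mem_range.2 hZ),
    ← Finset.add_sum_erase _ (fun x => y x * f x) (Finset.mem_range.2 hZ)]
  have : ∑ x ∈ (Finset.range N).erase Z, Function.update y Z (y Z + 1) x * f x =
      ∑ x ∈ (Finset.range N).erase Z, y x * f x := by
    refine Finset.sum_congr rfl fun x hx => ?_
    rw [Function.update_of_ne (Finset.ne_of_mem_erase hx)]
  rw [this, Function.update_self]
  ring

/-- Either at most `P Z` copies of item `Z` are used, or removing one copy leaves an admissible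
choice. This is the knapsack recursion on the level of sets. -/
theorem Items_update {N Z W : ℕ} (hZ : Z < N) (z : ℕ → ℕ → ℕ) (R : Set ((ℕ → ℕ) × ℕ)) (P : ℕ → ℕ) :
    Items N z W R (Function.update P Z (P Z + 1)) =
      Items N z W R P ∪ (fun q => (fun j => q.1 j + z Z j, q.2 + W)) '' Items N z W R P := by
  have key : ∀ y : ℕ → ℕ, ∀ p : (ℕ → ℕ) × ℕ,
      ((fun j => p.1 j + ∑ x ∈ Finset.range N, Function.update y Z (y Z + 1) x * z x j,
        p.2 + W * ∑ x ∈ Finset.range N, Function.update y Z (y Z + 1) x) : (ℕ → ℕ) × ℕ) =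
      (fun j => p.1 j + ∑ x ∈ Finset.range N, y x * z x j + z Z j,
        p.2 + W * ∑ x ∈ Finset.range N, y x + W) := by
    intro y p
    refine Prod.ext (funext fun j => ?_) ?_
    · dsimp only
      rw [sum_update_succ hZ y (fun x => z x j)]
      ring
    · have := sum_update_succ hZ y (fun _ => 1)
      simp only [mul_one] at this
      dsimp only
      rw [this]
      ring
  apply Set.Subset.antisymm
  · rintro q ⟨p, hp, y, hy, rfl⟩
    by_cases h : y Z ≤ P Z
    · refine Or.inl ⟨p, hp, y, fun x => ?_, rfl⟩
      by_cases hx : x = Z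
      · rw [hx]; exact h
      · simpa [hx] using hy x
    · have hyZ := hy Z
      rw [Function.update_self] at hyZ
      refine Or.inr ⟨_, ⟨p, hp, Function.update y Z (y Z - 1), fun x => ?_, rfl⟩, ?_⟩
      · by_cases hx : x = Z
        · subst hx; rw [Function.update_self]; omega
        · simpa [hx] using hy x
      · have h2 := key (Function.update y Z (y Z - 1)) p
        rw [Function.update_self, Function.update_idem, show y Z - 1 + 1 = y Z by omega,
          Function.update_eq_self] at h2
        exact h2.symm
  · refine Set.union_subset (Items_mono fun x => ?_) ?_
    · by_cases hx : x = Z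
      · subst hx; simp
      · simp [hx]
    · rintro _ ⟨_, ⟨p, hp, y, hy, rfl⟩, rfl⟩
      refine ⟨p, hp, Function.update y Z (y Z + 1), fun x => ?_, (key y p).symm⟩
      by_cases hx : x = Z
      · subst hx; simpa using hy x
      · simpa [hx] using hy x

/-- Codes are additive, so adding `z` to a vector shifts its index by `Z`; `hlt` keeps the shifted
indices inside the table. -/
theorem Rep.addItem {K m : ℕ} {R : Set ((ℕ → ℕ) × ℕ)} {T T' : ℕ → ℕ} (h : Rep K m R T)
    {z : ℕ → ℕ} {Z W : ℕ} (hz : enc K z m = Z)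
    (hlt : ∀ p ∈ R, enc K (fun j => p.1 j + z j) m < K ^ m)
    (hT : ∀ c < K ^ m, T' c = RAM.addItem W Z T c) :
    Rep K m (R ∪ (fun q => (fun j => q.1 j + z j, q.2 + W)) '' R) T' := by
  constructor
  · rintro _ (hp | ⟨p, hp, rfl⟩)
    · obtain ⟨h1, h2⟩ := h.1 _ hp
      refine ⟨h1, ?_⟩
      rw [hT _ h1, RAM.addItem]
      split_ifs
      · exact lt_max_of_lt_left h2
      · exact h2
    · obtain ⟨h1, h2⟩ := h.1 _ hp
      refine ⟨hlt p hp, ?_⟩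
      dsimp only
      rw [hT _ (hlt p hp), enc_add, hz, RAM.addItem, Nat.add_sub_cancel, if_pos ⟨by omega, by omega⟩]
      exact lt_max_of_lt_right (by omega)
  · intro c hc h0
    rw [hT c hc] at h0 ⊢
    unfold RAM.addItem at h0 ⊢
    split_ifs at h0 ⊢ with hcond
    · rcases max_choice (T c) (T (c - Z) + W) with hm | hm
      · rw [hm] at h0 ⊢
        obtain ⟨p, hp, h2⟩ := h.2 c hc h0
        exact ⟨p, Or.inl hp, h2⟩
      · rw [hm]
        obtain ⟨p, hp, h2, h5⟩ := h.2 (c - Z) (by omega) hcond.2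
        refine ⟨_, Or.inr ⟨p, hp, rfl⟩, ?_, ?_⟩
        · rw [enc_add, hz, h2]; omega
        · dsimp only; omega
    · obtain ⟨p, hp, h2⟩ := h.2 c hc h0
      exact ⟨p, Or.inl hp, h2⟩

/-! ### Splitting multiplicities -/

/-- The values that are reached from `R` by further using `y Z ≤ U Z` items of code `Z`, so that
every entry of the vector, with the items counted twice, is at most `b`. -/
def Vals (m N : ℕ) (z : ℕ → ℕ → ℕ) (U : ℕ → ℕ) (b W : ℕ) (R : Set ((ℕ → ℕ) × ℕ)) : Set ℕ :=
  {x | ∃ p ∈ R, ∃ y : ℕ → ℕ, (∀ Z, y Z ≤ U Z) ∧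
    (∀ j < m, p.1 j + 2 * ∑ Z ∈ Finset.range N, y Z * z Z j ≤ b) ∧
    x = p.2 + W * ∑ Z ∈ Finset.range N, y Z}

/-- Halve a vector, after adding `o` to all entries. -/
def halfVec (o : ℕ) (v : ℕ → ℕ) (j : ℕ) : ℕ := (v j + o) / 2

/-- The amount added before halving, when the bound is `b`. -/
def offset (b : ℕ) : ℕ := 1 - b % 2

/-- The values reachable after splitting off the odd items and halving all the rest. -/
theorem Vals_step (m N : ℕ) (z : ℕ → ℕ → ℕ) (U : ℕ → ℕ) (b W : ℕ) (R : Set ((ℕ → ℕ) × ℕ)) :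
    Vals m N z (fun Z => (U Z - 1) / 2) (b / 2) (2 * W)
      (Items N z W ((fun p => (halfVec (offset b) p.1, p.2)) '' R) fun Z => odds (U Z)) =
    Vals m N z U b W R := by
  have hsum : ∀ (y x : ℕ → ℕ) (f : ℕ → ℕ), ∑ Z ∈ Finset.range N, (y Z + 2 * x Z) * f Z =
      ∑ Z ∈ Finset.range N, y Z * f Z + 2 * ∑ Z ∈ Finset.range N, x Z * f Z := by
    intro y x f
    rw [Finset.mul_sum, ← Finset.sum_add_distrib]
    exact Finset.sum_congr rfl fun Z _ => by ring
  have hsum1 : ∀ (y x : ℕ → ℕ), ∑ Z ∈ Finset.range N, (y Z + 2 * x Z) =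
      ∑ Z ∈ Finset.range N, y Z + 2 * ∑ Z ∈ Finset.range N, x Z := by
    intro y x
    simpa using hsum y x fun _ => 1
  ext v
  constructor
  · rintro ⟨_, ⟨_, ⟨p, hp, rfl⟩, y, hy, rfl⟩, x, hx, hb, rfl⟩
    refine ⟨p, hp, fun Z => y Z + 2 * x Z, fun Z => ?_, fun j hj => ?_, ?_⟩
    · have h1 : y Z ≤ U Z - 2 * ((U Z - 1) / 2) := hy Z
      have h2 : x Z ≤ (U Z - 1) / 2 := hx Z
      dsimp only
      omega
    -- For integers, `p + 2 * S ≤ b` is equivalent to `S` plus `p / 2` being at most `b / 2` rounded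
    -- down, where `p / 2` is rounded down if `b` is odd and up if `b` is even. `offset b` selects
    -- this rounding.
    · have := hb j hj
      rw [hsum y x fun Z => z Z j]
      simp only [halfVec, offset] at this
      omega
    · rw [hsum1]
      ring
  · rintro ⟨p, hp, u, hu, hb, rfl⟩
    -- Take as many pairs as the remaining multiplicity permits. If `x Z = u Z / 2`, at most one
    -- item is left over, and then `U Z` is positive; otherwise `x Z = (U Z - 1) / 2` and the rest
    -- is at most `U Z - 2 * x Z = odds (U Z)`.
    obtain ⟨x, hx⟩ : ∃ x : ℕ → ℕ, ∀ Z, x Z = min ((U Z - 1) / 2) (u Z / 2) := ⟨_, fun _ => rfl⟩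
    obtain ⟨y, hy⟩ : ∃ y : ℕ → ℕ, ∀ Z, y Z = u Z - 2 * x Z := ⟨_, fun _ => rfl⟩
    have huxy : u = fun Z => y Z + 2 * x Z := by
      funext Z
      rw [hy, hx]
      omega
    refine ⟨_, ⟨_, ⟨p, hp, rfl⟩, y, fun Z => ?_, rfl⟩, x, fun Z => ?_, fun j hj => ?_, ?_⟩
    · have := hu Z
      rw [hy, hx]
      dsimp only [odds]
      omega
    · rw [hx]
      exact min_le_left _ _
    · have := hb j hj
      rw [huxy] at this
      rw [hsum y x fun Z => z Z j] at this
      simp only [halfVec, offset]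
      omega
    · rw [huxy, hsum1]
      ring

theorem Vals_end {m N : ℕ} {z : ℕ → ℕ → ℕ} {U : ℕ → ℕ} {W x : ℕ} {R : Set ((ℕ → ℕ) × ℕ)}
    (hU : ∀ Z, U Z = 0) :
    x ∈ Vals m N z U 0 W R ↔ ∃ p ∈ R, (∀ j < m, p.1 j = 0) ∧ x = p.2 := by
  constructor
  · rintro ⟨p, hp, y, hy, hb, rfl⟩
    have : ∀ Z, y Z = 0 := fun Z => by have := hy Z; rw [hU] at this; omega
    exact ⟨p, hp, fun j hj => by have := hb j hj; omega, by simp [this]⟩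
  · rintro ⟨p, hp, h0, rfl⟩
    exact ⟨p, hp, fun _ => 0, fun _ => Nat.zero_le _, fun j hj => by simp [h0 j hj], by simp⟩

/-- The bound `4 * M + 1` reproduces itself: halving leaves at most `2 * M + 1`, and at most two
copies of each of at most `M` items with entries at most `1` add at most `2 * M`. This makes the
table size independent of the number of levels. -/
theorem Items_half_le {N m M o : ℕ} {z : ℕ → ℕ → ℕ} {U : ℕ → ℕ} {W : ℕ}
    {R : Set ((ℕ → ℕ) × ℕ)} (ho : o ≤ 1) (hz : ∀ Z j, z Z j ≤ 1)
    (hM : ((Finset.range N).filter fun Z => U Z ≠ 0).card ≤ M)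
    (hR : ∀ p ∈ R, ∀ j < m, p.1 j ≤ 4 * M + 1) :
    ∀ p ∈ Items N z W ((fun p => (halfVec o p.1, p.2)) '' R) fun Z => odds (U Z),
      ∀ j < m, p.1 j ≤ 4 * M + 1 := by
  rintro _ ⟨_, ⟨p, hp, rfl⟩, y, hy, rfl⟩ j hj
  have h1 : ∑ Z ∈ Finset.range N, y Z * z Z j ≤
      ∑ Z ∈ Finset.range N, if U Z ≠ 0 then 2 else 0 := by
    refine Finset.sum_le_sum fun Z _ => ?_
    have h2 : y Z ≤ odds (U Z) := hy Z
    have h3 : y Z * z Z j ≤ y Z * 1 := Nat.mul_le_mul_left _ (hz Z j)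
    have h4 := odds_le (U Z)
    split_ifs with h
    · omega
    · have h5 : U Z = 0 := not_not.1 h
      rw [h5] at h2
      unfold odds at h2
      omega
  rw [← Finset.sum_filter, Finset.sum_const, smul_eq_mul] at h1
  have := hR p hp j hj
  simp only [halfVec]
  omega

/-! ### Rows as vectors -/

section Rows

variable {w m : ℕ} (K : ℕ) (A : Matrix (Fin w) (Fin m) Bool)

/-- The vector that indicates the `0`s of a row. -/
def boolVec (a : Fin m → Bool) (j : ℕ) : ℕ :=
  if h : j < m then if a ⟨j, h⟩ = true then 0 else 1 else 0

/-- The number of a row. -/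
def rowCode (i : Fin w) : ℕ := enc K (boolVec (A i)) m

/-- The number of rows with code `Z`. -/
def mult (Z : ℕ) : ℕ := (Finset.univ.filter fun i => rowCode K A i = Z).card

open Classical in
/-- The vector of the rows with code `Z`. -/
noncomputable def codeVec (Z j : ℕ) : ℕ :=
  if ∃ i, rowCode K A i = Z ∧ boolVec (A i) j = 1 then 1 else 0

variable {K A}

theorem boolVec_le (a : Fin m → Bool) (j : ℕ) : boolVec a j ≤ 1 := by
  unfold boolVec
  split_ifs <;> omega

theorem boolVec_of_le (a : Fin m → Bool) {j : ℕ} (h : m ≤ j) : boolVec a j = 0 :=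
  dif_neg (by omega)

theorem codeVec_le (Z j : ℕ) : codeVec K A Z j ≤ 1 := by
  unfold codeVec
  split_ifs <;> omega

/-- The digits are at most `1 < K`, so by `enc_inj` all rows with the same code have the same zeros,
and any of them determines the vector. -/
theorem codeVec_rowCode (hK : 2 ≤ K) (i : Fin w) : codeVec K A (rowCode K A i) = boolVec (A i) := by
  funext j
  have hle := boolVec_le (A i) j
  unfold codeVec
  split_ifs with h
  · obtain ⟨i', he, h1⟩ := h
    by_cases hj : j < m
    · rw [← h1]
      exact enc_inj (fun j _ => by have := boolVec_le (A i') j; omega)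
        (fun j _ => by have := boolVec_le (A i) j; omega) he j hj
    · rw [boolVec_of_le _ (by omega)] at h1
      omega
  · by_contra hne
    exact h ⟨i, rfl, by omega⟩

theorem exists_of_mult_ne_zero {Z : ℕ} (h : mult K A Z ≠ 0) : ∃ i, rowCode K A i = Z := by
  obtain ⟨i, hi⟩ := Finset.card_ne_zero.1 h
  exact ⟨i, (Finset.mem_filter.1 hi).2⟩

theorem enc_codeVec (hK : 2 ≤ K) {Z : ℕ} (h : mult K A Z ≠ 0) : enc K (codeVec K A Z) m = Z := by
  obtain ⟨i, rfl⟩ := exists_of_mult_ne_zero h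
  rw [codeVec_rowCode hK]
  rfl

theorem rowCode_lt (hK : 2 ≤ K) (i : Fin w) : rowCode K A i < K ^ m :=
  enc_lt fun j _ => by have := boolVec_le (A i) j; omega

theorem mult_eq_zero (hK : 2 ≤ K) {Z : ℕ} (h : K ^ m ≤ Z) : mult K A Z = 0 := by
  by_contra hne
  obtain ⟨i, rfl⟩ := exists_of_mult_ne_zero hne
  have := rowCode_lt (A := A) hK i
  omega

theorem mult_le (Z : ℕ) : mult K A Z ≤ w :=
  (Finset.card_le_univ _).trans (by simp)

/-- An occurring code comes from one of the `2 ^ m` Boolean rows, however large `w` and the range of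
codes are. -/
theorem card_mult_ne_zero (N : ℕ) :
    ((Finset.range N).filter fun Z => mult K A Z ≠ 0).card ≤ 2 ^ m := by
  classical
  have hsub : ((Finset.range N).filter fun Z => mult K A Z ≠ 0) ⊆
      Finset.univ.image fun a : Fin m → Bool => enc K (boolVec a) m := by
    intro Z hZ
    obtain ⟨i, hi⟩ := exists_of_mult_ne_zero (Finset.mem_filter.1 hZ).2
    exact Finset.mem_image.2 ⟨A i, Finset.mem_univ _, hi⟩
  refine (Finset.card_le_card hsub).trans (Finset.card_image_le.trans ?_)
  simp

/-- The rows in `S` can be kept. -/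
def Keepable (A : Matrix (Fin w) (Fin m) Bool) (S : Finset (Fin w)) : Prop :=
  ∀ j < m, 1 + 2 * ∑ i ∈ S, boolVec (A i) j ≤ w

theorem Keepable.subset {S S' : Finset (Fin w)} (h : Keepable A S) (hs : S' ⊆ S) :
    Keepable A S' := fun j hj => by
  have := Finset.sum_le_sum_of_subset (f := fun i => boolVec (A i) j) hs
  have := h j hj
  omega

/-- After the flip, the zeros of a column are exactly those in the kept rows. Zeros and ones
together number `w`, so a strict majority of ones says that twice the zeros plus one is at most `w`.
-/
theorem columnMajorities_iff (S : Finset (Fin w)) :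
    ColumnMajorities (flipRows A S) ↔ Keepable A Sᶜ := by
  have hcard : ∀ j : Fin m, (Finset.univ.filter fun i => flipRows A S i j = false).card =
      ∑ i ∈ Sᶜ, boolVec (A i) j := by
    intro j
    rw [Finset.card_filter, ← Finset.sum_add_sum_compl S]
    have h1 : ∑ i ∈ S, (if flipRows A S i j = false then 1 else 0) = 0 :=
      Finset.sum_eq_zero fun i hi => by simp [flipRows, hi]
    rw [h1, zero_add]
    refine Finset.sum_congr rfl fun i hi => ?_
    have := Finset.mem_compl.1 hi
    cases h : A i j <;> simp [flipRows, this, boolVec, h]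
  have htot : ∀ j : Fin m, (Finset.univ.filter fun i => flipRows A S i j = false).card +
      (Finset.univ.filter fun i => flipRows A S i j = true).card = w := by
    intro j
    have := Finset.card_filter_add_card_filter_not (s := (Finset.univ : Finset (Fin w)))
      (fun i => flipRows A S i j = false)
    simpa using this
  constructor
  · intro h j hj
    have h1 := h ⟨j, hj⟩
    have h2 := htot ⟨j, hj⟩
    rw [hcard] at h1 h2
    dsimp only at h1 h2
    omega
  · intro h j
    have h1 := h j j.isLt
    have h2 := htot j
    rw [hcard] at h2 ⊢
    omega

theorem lobbying_iff (k : ℕ) :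
    Lobbying A k ↔ k ≤ w ∧ ∃ S : Finset (Fin w), S.card = w - k ∧ Keepable A S := by
  constructor
  · rintro ⟨S, hS, h⟩
    have hle : S.card ≤ w := (Finset.card_le_univ S).trans (by simp)
    refine ⟨hS ▸ hle, Sᶜ, ?_, (columnMajorities_iff S).1 h⟩
    rw [Finset.card_compl, Fintype.card_fin, hS]
  · rintro ⟨hk, S, hS, h⟩
    refine ⟨Sᶜ, ?_, (columnMajorities_iff _).2 (by rwa [compl_compl])⟩
    rw [Finset.card_compl, Fintype.card_fin, hS]
    omega

/-- Rows with equal code are interchangeable, so a set of rows may be replaced by its numbers of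
rows per code, and any admissible numbers come from a set. The all-ones start vector is the summand
`1` in `Keepable`, that is, the strictness of the majority. -/
theorem mem_Vals_start (hK : 2 ≤ K) (x : ℕ) :
    x ∈ Vals m (K ^ m) (codeVec K A) (mult K A) w 1 {(fun _ => 1, 0)} ↔
      ∃ S : Finset (Fin w), S.card = x ∧ Keepable A S := by
  classical
  have hmaps : ∀ S : Finset (Fin w), ∀ i ∈ S, rowCode K A i ∈ Finset.range (K ^ m) :=
    fun S i _ => Finset.mem_range.2 (rowCode_lt hK i)
  have hsum : ∀ (S : Finset (Fin w)) (j : ℕ), ∑ i ∈ S, boolVec (A i) j =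
      ∑ Z ∈ Finset.range (K ^ m), (S.filter fun i => rowCode K A i = Z).card * codeVec K A Z j := by
    intro S j
    rw [← Finset.sum_fiberwise_of_maps_to (hmaps S)]
    refine Finset.sum_congr rfl fun Z _ => ?_
    rw [← smul_eq_mul, ← Finset.sum_const]
    refine Finset.sum_congr rfl fun i hi => ?_
    rw [← (Finset.mem_filter.1 hi).2, codeVec_rowCode hK]
  constructor
  · rintro ⟨p, hp, y, hy, hb, rfl⟩
    obtain rfl := Set.mem_singleton_iff.1 hp
    have hex : ∀ Z, ∃ t ⊆ Finset.univ.filter fun i => rowCode K A i = Z, t.card = y Z :=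
      fun Z => Finset.exists_subset_card_eq (hy Z)
    choose t ht htc using hex
    have hmem : ∀ Z i, i ∈ t Z → rowCode K A i = Z := fun Z i hi =>
      (Finset.mem_filter.1 (ht Z hi)).2
    obtain ⟨S, hS⟩ : ∃ S : Finset (Fin w), S = Finset.univ.filter fun i => i ∈ t (rowCode K A i) :=
      ⟨_, rfl⟩
    have hfib : ∀ Z, (S.filter fun i => rowCode K A i = Z).card = y Z := by
      intro Z
      rw [← htc Z]
      congr 1
      ext i
      simp only [hS, Finset.mem_filter, Finset.mem_univ, true_and]
      constructor
      · rintro ⟨h1, rfl⟩; exact h1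
      · intro h1
        have := hmem Z i h1
        exact ⟨by rwa [this], this⟩
    refine ⟨S, ?_, fun j hj => ?_⟩
    · rw [Finset.card_eq_sum_card_fiberwise (hmaps S)]
      simp [hfib]
    · rw [hsum]
      simpa only [hfib] using hb j hj
  · rintro ⟨S, rfl, hS⟩
    refine ⟨_, rfl, fun Z => (S.filter fun i => rowCode K A i = Z).card, fun Z => ?_,
      fun j hj => ?_, ?_⟩
    · exact Finset.card_le_card (Finset.filter_subset_filter _ (Finset.subset_univ _))
    · have := hS j hj
      rwa [hsum] at this
    · rw [Finset.card_eq_sum_card_fiberwise (hmaps S)]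
      simp

end Rows

/-! ### One level of the scaling -/

/-- The situation before a level: the table of multiplicities `U`, the bound `b`, the weight `W` and
the table of best values for `R` are in place. -/
structure LevelState (m K w k : ℕ) (z : ℕ → ℕ → ℕ) (U : ℕ → ℕ) (b W : ℕ) (R : Set ((ℕ → ℕ) × ℕ))
    (s : State) : Prop where
  reg_zero : s.reg 0 = w
  reg_two : s.reg 2 = k
  reg_three : s.reg 3 = 0
  reg_four : s.reg 4 = 1
  reg_seven : s.reg 7 = K ^ m
  reg_eight : s.reg 8 = enc K (fun _ => 1) m
  reg_ten : s.reg 10 = s.reg 9 + K ^ m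
  reg_eleven : s.reg 11 = s.reg 10 + K ^ m
  reg_twelve : s.reg 12 = b
  reg_thirteen : s.reg 13 = W
  reg_twentyfive : s.reg 25 = 2
  bound_le : b ≤ w
  vec_le : ∀ Z j, z Z j ≤ 1
  vec_code : ∀ Z, U Z ≠ 0 → enc K (z Z) m = Z
  mult_zero : ∀ Z, K ^ m ≤ Z → U Z = 0
  mult_le : ∀ Z, U Z ≤ w
  card_le : ((Finset.range (K ^ m)).filter fun Z => U Z ≠ 0).card ≤ 2 ^ m
  reached_le : ∀ p ∈ R, ∀ j < m, p.1 j ≤ 4 * 2 ^ m + 1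
  mem_mult : ∀ c < K ^ m, s.mem (s.reg 10 + c) = U c
  mem_half_zero : s.mem (s.reg 11) = 0
  mem_half : ∀ r < K ^ m, ∀ d < K,
    s.mem (s.reg 11 + (K * r + d)) = K * s.mem (s.reg 11 + r) + d / 2
  rep : Rep K m R fun x => s.mem (s.reg 9 + x)

/-- One level: halve the vectors, then use the odd items. -/
def levelProg : Prog :=
  block [
    .sub 16 12 4,
    halfUp,
    .add 17 15 15,
    .sub 18 12 17,
    .sub 17 4 18,
    .cond 17 (.add 17 8 3) .skip,
    .add 12 15 3,
    pushProg,
    itemsProg,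
    .add 13 13 13,
    .sub 14 14 4]

/-- The vectors reached in one level. -/
def levelSet (N : ℕ) (z : ℕ → ℕ → ℕ) (U : ℕ → ℕ) (b W : ℕ) (R : Set ((ℕ → ℕ) × ℕ)) :
    Set ((ℕ → ℕ) × ℕ) :=
  Items N z W ((fun p => (halfVec (offset b) p.1, p.2)) '' R) fun Z => odds (U Z)

theorem offset_le (b : ℕ) : offset b ≤ 1 := by unfold offset; omega

theorem enc_const_zero (K m : ℕ) : enc K (fun _ => 0) m = 0 := by
  induction m with
  | zero => rfl
  | succ m ih => simp [enc, ih]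

/-- The set `R` and the multiplicities `U` change exactly as in `Vals_step`. The choice of `K`
leaves room for the digit bound `4 * 2 ^ m + 1` and for the offset added before halving. -/
theorem wp_levelProg {m K w k b W : ℕ} {z : ℕ → ℕ → ℕ} {U : ℕ → ℕ} {R : Set ((ℕ → ℕ) × ℕ)}
    {s : State} (hK : K = 8 * 2 ^ m) (h : LevelState m K w k z U b W R s) :
    WP levelProg s fun s' t =>
      (LevelState m K w k z (fun Z => (U Z - 1) / 2) (b / 2) (2 * W) (levelSet (K ^ m) z U b W R) s' ∧
        s'.reg 14 = s.reg 14 - 1) ∧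
      t ≤ K ^ m * (3 * w + 32 * K ^ m + 66) + 3 * w + 30 := by
  have hpow : 1 ≤ 2 ^ m := Nat.one_le_two_pow
  obtain ⟨N, hN⟩ : ∃ N, N = K ^ m := ⟨_, rfl⟩
  have hN0 : 0 < N := by rw [hN]; exact Nat.pow_pos (by omega)
  obtain ⟨o, ho⟩ : ∃ o, o = enc K (fun _ => offset b) m := ⟨_, rfl⟩
  have hoff := offset_le b
  have hodef : o = if offset b = 0 then 0 else enc K (fun _ => 1) m := by
    rw [ho]
    split_ifs with h0
    · rw [h0, enc_const_zero]
    · rw [show offset b = 1 by omega]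
  have hoN : o < N := by
    rw [ho, hN]
    exact enc_lt fun _ _ => by omega
  simp only [levelProg, block, wp_seq, wp_sub]
  refine (wp_halfUp (by simpa using h.reg_four) (by simpa using h.reg_twentyfive)).mono ?_
  rintro s₁ t₁ ⟨⟨a1, a2, a5⟩, at1⟩
  simp only [reg_setReg, mem_setReg, reduceIte, h.reg_twelve, h.reg_four] at a1 a5 at1
  have a1' : s₁.reg 15 = b / 2 := by omega
  have hbw := h.bound_le
  have a15 : ∀ x, x ≠ 15 → x ≠ 16 → s₁.reg x = s.reg x := by
    intro x hx hx'
    rw [a2 x hx hx', reg_setReg, if_neg hx']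
  have a4 : s₁.reg 4 = 1 := by rw [a15 4 (by omega) (by omega), h.reg_four]
  have a3 : s₁.reg 3 = 0 := by rw [a15 3 (by omega) (by omega), h.reg_three]
  have a8 : s₁.reg 8 = enc K (fun _ => 1) m := by rw [a15 8 (by omega) (by omega), h.reg_eight]
  have a12 : s₁.reg 12 = b := by rw [a15 12 (by omega) (by omega), h.reg_twelve]
  -- Both branches of the test on register `17` end in this state: `o` is `0` or the code of the
  -- all-ones vector according to `offset b`.
  obtain ⟨s₂, hs₂⟩ : ∃ s₂ : State, s₂ = ((((s₁.setReg 17 (b / 2 + b / 2)).setReg 18 (b % 2)).setReg 17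
    (offset b)).setReg 17 o).setReg 12 (b / 2) := ⟨_, rfl⟩
  suffices H : WP pushProg s₂ fun s₃ t₃ => WP itemsProg s₃ fun s₄ t₄ =>
      (LevelState m K w k z (fun Z => (U Z - 1) / 2) (b / 2) (2 * W) (levelSet N z U b W R)
          ((s₄.setReg 13 (s₄.reg 13 + s₄.reg 13)).setReg 14 (s₄.reg 14 - s₄.reg 4)) ∧
        s₄.reg 14 - s₄.reg 4 = s.reg 14 - 1) ∧ t₃ + t₄ ≤ N * (3 * w + 32 * N + 66) + 4 by
    have hbit : b - (b / 2 + b / 2) = b % 2 := by omega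
    have hoff' : 1 - b % 2 = offset b := rfl
    simp only [wp_cond, wp_add, wp_skip]
    simp only [reg_setReg, reduceIte, Nat.reduceEqDiff, a1', a3, a4, a8, a12, hbit, hoff']
    have hfin : ∀ t₀ ≤ 3 * w + 20, WP pushProg s₂ fun s₃ t₃ => WP itemsProg s₃ fun s₄ t₄ =>
      (LevelState m K w k z (fun Z => (U Z - 1) / 2) (b / 2) (2 * W) (levelSet (K ^ m) z U b W R)
          ((s₄.setReg 13 (s₄.reg 13 + s₄.reg 13)).setReg 14 (s₄.reg 14 - s₄.reg 4)) ∧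
        s₄.reg 14 - s₄.reg 4 = s.reg 14 - 1) ∧
        t₀ + (t₃ + (t₄ + 2)) ≤ K ^ m * (3 * w + 32 * K ^ m + 66) + 3 * w + 30 := by
      intro t₀ ht₀
      refine H.mono fun s₃ t₃ h3 => h3.mono fun s₄ t₄ h4 => ⟨hN ▸ h4.1, ?_⟩
      have := h4.2
      rw [hN] at this
      omega
    split_ifs with hz
    · have e : ((((s₁.setReg 17 (b / 2 + b / 2)).setReg 18 (b % 2)).setReg 17 (offset b))).setReg 12
          (b / 2) = s₂ := by
        rw [hs₂, hodef, if_pos hz, hz]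
        simp [State.setReg]
      simp only [add_zero]
      rw [e]
      refine (hfin (t₁ + 7) (by omega)).mono fun s₃ t₃ h3 => h3.mono fun s₄ t₄ h4 => ⟨h4.1, ?_⟩
      have := h4.2
      omega
    · have e : ((((s₁.setReg 17 (b / 2 + b / 2)).setReg 18 (b % 2)).setReg 17 (offset b)).setReg 17
          (enc K (fun _ => 1) m)).setReg 12 (b / 2) = s₂ := by
        rw [hs₂, hodef, if_neg hz]
      simp only [add_zero]
      rw [e]
      refine (hfin (t₁ + 7) (by omega)).mono fun s₃ t₃ h3 => h3.mono fun s₄ t₄ h4 => ⟨h4.1, ?_⟩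
      have := h4.2
      omega
  have b1 : ∀ x, x ≠ 12 → x ≠ 15 → x ≠ 16 → x ≠ 17 → x ≠ 18 → s₂.reg x = s.reg x := by
    intro x hx hx1 hx2 hx3 hx4
    rw [← a15 x hx1 hx2, hs₂]
    simp [hx, hx3, hx4]
  have b5 : s₂.mem = s.mem := by rw [hs₂]; simp [a5]
  have b17 : s₂.reg 17 = o := by rw [hs₂]; simp
  have b12 : s₂.reg 12 = b / 2 := by rw [hs₂]; simp
  have b7 : s₂.reg 7 = N := by
    rw [b1 7 (by omega) (by omega) (by omega) (by omega) (by omega), h.reg_seven, hN]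
  have b9 : s₂.reg 9 = s.reg 9 := b1 9 (by omega) (by omega) (by omega) (by omega) (by omega)
  have b11 : s₂.reg 11 = s.reg 9 + N + N := by
    rw [b1 11 (by omega) (by omega) (by omega) (by omega) (by omega), h.reg_eleven, h.reg_ten, hN]
  have s10 : s.reg 10 = s.reg 9 + N := by rw [h.reg_ten, hN]
  have s11 : s.reg 11 = s.reg 9 + N + N := by rw [h.reg_eleven, h.reg_ten, hN]
  have hhalf : ∀ p ∈ R, s.mem (enc K p.1 m + o + s.reg 11) = enc K (halfVec (offset b) p.1) m := by
    intro p hp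
    -- Reading the lookup table at a position shifted by `o` halves the vector after adding the
    -- offset to every entry. Its digits are at most `4 * 2 ^ m + 2 < K`, as `half_enc` requires.
    rw [ho, ← enc_add, add_comm]
    refine half_enc (h := fun c => s.mem (s.reg 11 + c)) (by simpa using h.mem_half_zero)
      h.mem_half fun j hj => ?_
    have := h.reached_le p hp j hj
    omega
  have hhalfle : ∀ p : (ℕ → ℕ) × ℕ, enc K (halfVec (offset b) p.1) m ≤ enc K p.1 m :=
    fun p => enc_mono fun j _ => by unfold halfVec; omega
  refine (wp_pushProg (g := fun c => s.mem (c + o + s.reg 11))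
    (by rw [b1 3 (by omega) (by omega) (by omega) (by omega) (by omega), h.reg_three])
    (by rw [b1 4 (by omega) (by omega) (by omega) (by omega) (by omega), h.reg_four])
    (by omega) (fun c _ => by rw [b5, b17, b11, s11]) ?_).mono ?_
  · intro c hc h0
    rw [b9, b5] at h0
    rw [b7, hN] at hc
    obtain ⟨p, hp, rfl, -⟩ := h.rep.2 c hc h0
    rw [hhalf p hp]
    exact hhalfle p
  rintro s₃ t₃ ⟨⟨c1, c2, c5, c25⟩, ct⟩
  rw [b7, b9] at c1 c2
  rw [b7] at ct
  have hrep := h.rep.push (halfVec (offset b)) hhalf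
    (fun p hp => (hhalfle p).trans_lt (h.rep.1 p hp).1)
    (T' := fun x => s₃.mem (s.reg 9 + x)) (fun c hc => by rw [← hN] at hc ⊢; rw [c1 c hc, b5])
  have d1 : ∀ x, x ≠ 12 → x < 15 → s₃.reg x = s.reg x := by
    intro x hx hx'
    rw [c5 x (by omega), b1 x hx (by omega) (by omega) (by omega) (by omega)]
  have d3 : s₃.reg 3 = 0 := by rw [d1 3 (by omega) (by omega), h.reg_three]
  have d4 : s₃.reg 4 = 1 := by rw [d1 4 (by omega) (by omega), h.reg_four]
  have d7 : s₃.reg 7 = N := by rw [d1 7 (by omega) (by omega), h.reg_seven, hN]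
  have d9 : s₃.reg 9 = s.reg 9 := d1 9 (by omega) (by omega)
  have d10 : s₃.reg 10 = s.reg 9 + N := by rw [d1 10 (by omega) (by omega), s10]
  have d12 : s₃.reg 12 = b / 2 := by rw [c5 12 (by omega), b12]
  have d13 : s₃.reg 13 = W := by rw [d1 13 (by omega) (by omega), h.reg_thirteen]
  have d25 : s₃.reg 25 = 2 := by
    rw [c25, b1 25 (by omega) (by omega) (by omega) (by omega) (by omega), h.reg_twentyfive]
  have hlevel : ∀ q ∈ levelSet N z U b W R, ∀ j < m, q.1 j ≤ 4 * 2 ^ m + 1 :=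
    Items_half_le hoff h.vec_le (hN ▸ h.card_le) h.reached_le
  refine (wp_itemsProg (w := w) d3 d4 d25 (by omega) U
    (fun c hc => ?_) (fun c hc => h.mult_zero c (by rw [← hN]; omega)) h.mult_le
    (fun P T => Rep K m (Items N z W ((fun p : (ℕ → ℕ) × ℕ => (halfVec (offset b) p.1, p.2)) '' R) P) T)
    ?_ (fun P T T' hT hR => hR.congr fun c hc => hT c (by omega)) ?_).mono ?_
  · rw [d10, c2 _ (by omega), b5, ← s10, h.mem_mult c (by omega)]
  · intro P Z T T' hP hPZ hZ hR hT
    rw [d7] at hZ hT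
    rw [d13] at hT
    -- All intermediate sets of the level lie in the final one, so its digit bound keeps every index
    -- inside the table throughout.
    have hup : Items N z W ((fun p => (halfVec (offset b) p.1, p.2)) '' R)
        (Function.update P Z (P Z + 1)) ⊆ levelSet N z U b W R := by
      refine Items_mono fun x => ?_
      by_cases hx : x = Z
      · subst hx; rw [Function.update_self]; exact hPZ
      · rw [Function.update_of_ne hx]; exact hP x
    have hUZ : U Z ≠ 0 := fun h0 => by rw [h0] at hPZ; simp [odds] at hPZ
    rw [Items_update hZ] at hup ⊢
    refine hR.addItem (h.vec_code Z hUZ) (fun p hp => enc_lt fun j hj => ?_)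
      (fun c hc => hT c (by omega))
    have := hlevel _ (hup (Or.inr ⟨p, hp, rfl⟩)) j hj
    dsimp only at this
    omega
  · rw [Items_zero, d9]
    exact hrep
  rintro s₄ t₄ ⟨⟨e1, e2, e5, e6, e25⟩, et⟩
  rw [d7] at et e2 e5
  rw [d9] at e1 e5
  rw [d10] at e2 e5
  have f1 : ∀ x, x ≠ 12 → x < 15 → s₄.reg x = s.reg x := fun x hx hx' => by
    rw [e6 x hx', d1 x hx hx']
  have f13 : s₄.reg 13 = W := by rw [f1 13 (by omega) (by omega), h.reg_thirteen]
  have f10 : s₄.reg 10 = s.reg 9 + N := by rw [f1 10 (by omega) (by omega), s10]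
  have f11 : s₄.reg 11 = s.reg 11 := f1 11 (by omega) (by omega)
  have f9 : s₄.reg 9 = s.reg 9 := f1 9 (by omega) (by omega)
  have f4 : s₄.reg 4 = 1 := by rw [f1 4 (by omega) (by omega), h.reg_four]
  have hmemH : ∀ c, s₄.mem (s.reg 11 + c) = s.mem (s.reg 11 + c) := fun c => by
    rw [e5 _ (by omega), c2 _ (by omega), b5]
  refine ⟨⟨?_, by rw [f4, f1 14 (by omega) (by omega)]⟩, ?_⟩
  · exact {
      reg_zero := by simp [f1 0 (by omega) (by omega), h.reg_zero]
      reg_two := by simp [f1 2 (by omega) (by omega), h.reg_two]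
      reg_three := by simp [f1 3 (by omega) (by omega), h.reg_three]
      reg_four := by simp [f4]
      reg_seven := by simp [f1 7 (by omega) (by omega), h.reg_seven]
      reg_eight := by simp [f1 8 (by omega) (by omega), h.reg_eight]
      reg_ten := by simp [f10, f9, hN]
      reg_eleven := by simp [f11, f10, s11, hN]
      reg_twelve := by simp [e6 12, d12]
      reg_thirteen := by simp [f13, two_mul]
      reg_twentyfive := by simp [e25, d25]
      bound_le := by omega
      vec_le := h.vec_le
      vec_code := fun Z hZ => h.vec_code Z fun h0 => hZ (by rw [h0])
      mult_zero := fun Z hZ => by rw [h.mult_zero Z hZ]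
      mult_le := fun Z => by have := h.mult_le Z; omega
      card_le := by
        refine (Finset.card_le_card fun Z hZ => ?_).trans h.card_le
        rw [Finset.mem_filter] at hZ ⊢
        exact ⟨hZ.1, fun h0 => hZ.2 (by rw [h0])⟩
      reached_le := hlevel
      mem_mult := fun c hc => by
        rw [← hN] at hc
        simpa [f10] using e2 c hc
      mem_half_zero := by
        have := hmemH 0
        simp only [add_zero] at this
        simp [f11, this, h.mem_half_zero]
      mem_half := fun r hr d hd => by
        simpa [f11, hmemH] using h.mem_half r hr d hd
      rep := by simpa [f9, levelSet] using e1 }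
  · have : N * (3 * w + 32 * N + 66) = N * (3 * w + 32 * N + 50) + 16 * N := by ring
    omega

/-! ### Setting up parameters, multiplicities and the halving table -/

/-- Compute the parameters: `2`, `m + 3`, the base `K = 2 ^ (m + 3)`, the power `K ^ m`, the code of
the all-ones vector, and the base addresses of the three tables. -/
def paramProg : Prog :=
  block [
    .const 4 1,
    .const 25 2,
    .const 15 3,
    .add 5 1 15,
    .const 6 1,
    shiftReg 6 5,
    .const 7 1,
    .const 8 0,
    .add 20 1 3,
    .loop 20 (block [shiftReg 7 5, shiftReg 8 5, .add 8 8 4, .sub 20 20 4]),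
    .const 9 0,
    .add 20 0 3,
    .loop 20 (block [.add 9 9 1, .sub 20 20 4]),
    .add 10 9 7,
    .add 11 10 7]

/-- In the absence of multiplication, `K ^ m` arises from `m` shifts by `m + 3` bits, the all-ones
code by a Horner scheme with such shifts, and `w * m` from `w` additions. -/
theorem wp_paramProg {s : State} {w m : ℕ} (h0 : s.reg 0 = w) (h1 : s.reg 1 = m)
    (h3 : s.reg 3 = 0) :
    WP paramProg s fun s' t =>
      (s'.reg 0 = w ∧ s'.reg 1 = m ∧ s'.reg 2 = s.reg 2 ∧ s'.reg 3 = 0 ∧ s'.reg 4 = 1 ∧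
        s'.reg 5 = m + 3 ∧ s'.reg 6 = 2 ^ (m + 3) ∧ s'.reg 7 = (2 ^ (m + 3)) ^ m ∧
        s'.reg 8 = enc (2 ^ (m + 3)) (fun _ => 1) m ∧ s'.reg 9 = w * m ∧
        s'.reg 10 = s'.reg 9 + s'.reg 7 ∧ s'.reg 11 = s'.reg 10 + s'.reg 7 ∧ s'.reg 25 = 2 ∧
        s'.mem = s.mem) ∧
      t ≤ m * (6 * m + 25) + 3 * m + 3 * w + 25 := by
  obtain ⟨K, hK⟩ : ∃ K, K = 2 ^ (m + 3) := ⟨_, rfl⟩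
  rw [← hK]
  simp only [paramProg, block, wp_seq, wp_const, wp_add]
  refine (wp_shiftReg (by simpa using h3) (by simp) (by omega) (by omega)).mono ?_
  rintro s₁ t₁ ⟨⟨a1, a2, a5⟩, at1⟩
  simp [h1] at a1 a5 at1
  have hs : ∀ x < 50, x ≠ 6 → s₁.reg x = if x = 5 then m + 3 else if x = 15 then 3 else
      if x = 25 then 2 else if x = 4 then 1 else s.reg x := by
    intro x hx hx'
    rw [a2 x hx' hx]
    simp [hx', h1]
  have e0 : s₁.reg 0 = w := by simp [hs, h0]
  have e1 : s₁.reg 1 = m := by simp [hs, h1]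
  have e2 : s₁.reg 2 = s.reg 2 := by simp [hs]
  have e3 : s₁.reg 3 = 0 := by simp [hs, h3]
  have e4 : s₁.reg 4 = 1 := by simp [hs]
  have e5 : s₁.reg 5 = m + 3 := by simp [hs]
  have e25 : s₁.reg 25 = 2 := by simp [hs]
  clear hs a2
  rw [← hK] at a1
  refine WP.mono (wp_loop (n := m) (fun i s' => s'.reg 20 = m - i ∧ s'.reg 7 = K ^ i ∧
    s'.reg 8 = enc K (fun _ => 1) i ∧ s'.mem = s.mem ∧
    (∀ x < 50, x ≠ 7 → x ≠ 8 → x ≠ 20 → s'.reg x = s₁.reg x)) (6 * m + 24) ?_ ?_ ?_) ?_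
  · exact fun i s' _ h => h.1
  · rintro i s₂ hi ⟨b1, b2, b5, b6, b7⟩
    simp only [wp_seq, wp_add, wp_sub]
    have b4 := b7 4 (by omega) (by omega) (by omega) (by omega)
    have b3 := b7 3 (by omega) (by omega) (by omega) (by omega)
    have b55 := b7 5 (by omega) (by omega) (by omega) (by omega)
    refine (wp_shiftReg (by rw [b3, e3]) (by rw [b4, e4]) (by omega) (by omega)).mono ?_
    rintro s₃ t₃ ⟨⟨c1, c2, c5⟩, ct⟩
    refine (wp_shiftReg (by rw [c2 3 (by omega) (by omega), b3, e3])
      (by rw [c2 4 (by omega) (by omega), b4, e4]) (by omega) (by omega)).mono ?_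
    rintro s₄ t₄ ⟨⟨d1, d2, d5⟩, dt⟩
    rw [c2 8 (by omega) (by omega), c2 5 (by omega) (by omega), b55, e5, ← hK, b5] at d1
    rw [c2 5 (by omega) (by omega), b55, e5] at dt
    rw [b55, e5, ← hK, b2] at c1
    rw [b55, e5] at ct
    have d4 : s₄.reg 4 = 1 := by
      rw [d2 4 (by omega) (by omega), c2 4 (by omega) (by omega), b4, e4]
    refine ⟨⟨?_, ?_, ?_, ?_, ?_⟩, by omega⟩
    · simp [d2 20 (by omega) (by omega), c2 20 (by omega) (by omega), b1, d4]; omega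
    · simp [d2 7 (by omega) (by omega), c1, pow_succ]
    · simp [d1, d4, enc, mul_comm]
    · simp [d5, c5, b6]
    · intro x hx hx1 hx2 hx3
      simp [hx2, hx3, d2 x hx2 hx, c2 x hx1 hx, b7 x hx hx1 hx2 hx3]
  · refine ⟨by simp [e1, e3], by simp, by simp [enc], by simp [a5], fun x hx hx1 hx2 hx3 => ?_⟩
    simp [hx1, hx2, hx3]
  rintro s₂ t₂ ⟨⟨b1, b2, b5, b6, b7⟩, bt⟩
  rw [show 6 * m + 24 + 1 = 6 * m + 25 from rfl] at bt
  have f : ∀ x < 7, s₂.reg x = s₁.reg x := fun x hx =>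
    b7 x (by omega) (by omega) (by omega) (by omega)
  refine WP.mono (wp_loop (n := w) (fun i s' => s'.reg 20 = w - i ∧ s'.reg 9 = i * m ∧
    s'.mem = s.mem ∧ (∀ x < 50, x ≠ 9 → x ≠ 20 → s'.reg x = s₂.reg x)) 2 ?_ ?_ ?_) ?_
  · exact fun i s' _ h => h.1
  · rintro i s₃ hi ⟨c1, c2, c5, c6⟩
    simp only [wp_seq, wp_add, wp_sub]
    have c4 : s₃.reg 4 = 1 := by rw [c6 4 (by omega) (by omega) (by omega), f 4 (by omega), e4]
    have c11 : s₃.reg 1 = m := by rw [c6 1 (by omega) (by omega) (by omega), f 1 (by omega), e1]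
    refine ⟨⟨?_, ?_, ?_, ?_⟩, by omega⟩
    · simp [c1, c4]; omega
    · simp [c2, c11]; ring
    · simp [c5]
    · intro x hx hx1 hx2
      simp [hx1, hx2, c6 x hx hx1 hx2]
  · refine ⟨by simp [f, e0, e3], by simp, by simp [b6], fun x hx hx1 hx2 => by simp [hx1, hx2]⟩
  rintro s₃ t₃ ⟨⟨c1, c2, c5, c6⟩, ct⟩
  have g : ∀ x < 7, s₃.reg x = s₁.reg x := fun x hx => by
    rw [c6 x (by omega) (by omega) (by omega), f x hx]
  have g25 : s₃.reg 25 = 2 := by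
    rw [c6 25 (by omega) (by omega) (by omega),
      b7 25 (by omega) (by omega) (by omega) (by omega), e25]
  have g7 := c6 7 (by omega) (by omega) (by omega)
  have g8 := c6 8 (by omega) (by omega) (by omega)
  refine ⟨⟨?_, ?_, ?_, ?_, ?_, ?_, ?_, ?_, ?_, ?_, ?_, ?_, ?_, ?_⟩, ?_⟩
  · simp [g, e0]
  · simp [g, e1]
  · simp [g, e2]
  · simp [g, e3]
  · simp [g, e4]
  · simp [g, e5]
  · simp [g, a1]
  · simp [g7, b2]
  · simp [g8, b5]
  · simp [c2]
  · simp
  · simp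
  · simp [g25]
  · simp [c5]
  · omega

/-- Count the rows of every code, in the table with base address `reg 10`. -/
def countProg : Prog :=
  block [
    .const 15 0,
    .add 20 0 3,
    .loop 20 (block [
      .const 16 0,
      .add 21 1 3,
      .loop 21 (block [
        shiftReg 16 5,
        .load 22 15,
        .cond 22 .skip (.add 16 16 4),
        .add 15 15 4,
        .sub 21 21 4]),
      .add 23 10 16,
      .load 24 23,
      .add 24 24 4,
      .store 23 24,
      .sub 20 20 4])]

/-- A row is read by a Horner scheme in base `K`, an entry `0` giving the digit `1`. The counters
start at `0` because their cells lie beyond the input, by `h10`. -/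
theorem wp_countProg {s : State} {w m k K : ℕ} {A : Matrix (Fin w) (Fin m) Bool}
    (h0 : s.reg 0 = w) (h1 : s.reg 1 = m) (h3 : s.reg 3 = 0) (h4 : s.reg 4 = 1)
    (h5 : s.reg 5 = m + 3) (hK : K = 2 ^ (m + 3)) (h10 : w * m ≤ s.reg 10)
    (hmem : s.mem = (inputState A k).mem) :
    WP countProg s fun s' t =>
      ((∀ x < 15, s'.reg x = s.reg x) ∧ s'.reg 25 = s.reg 25 ∧
        ∀ x, s'.mem x = if s.reg 10 ≤ x ∧ x < s.reg 10 + K ^ m then mult K A (x - s.reg 10)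
          else s.mem x) ∧
      t ≤ w * (m * (3 * m + 17) + 9) + 3 := by
  obtain ⟨a, ha⟩ : ∃ a, a = s.reg 10 := ⟨_, rfl⟩
  rw [← ha] at h10
  rw [← ha]
  have hK2 : 2 ≤ K := by rw [hK, pow_succ]; have := Nat.one_le_two_pow (n := m + 2); omega
  obtain ⟨code, hcode⟩ : ∃ code : ℕ → ℕ, code = fun i => if h : i < w then rowCode K A ⟨i, h⟩ else 0 :=
    ⟨_, rfl⟩
  have hmult : ∀ Z, mult K A Z = ∑ i ∈ Finset.range w, if code i = Z then 1 else 0 := by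
    intro Z
    rw [mult, Finset.card_filter, Finset.sum_range]
    refine Finset.sum_congr rfl fun i _ => ?_
    simp [hcode]
  have hentry : ∀ x < w * m, x < a := fun x hx => by omega
  simp only [countProg, block, wp_seq, wp_add, wp_const]
  refine WP.mono (wp_loop (n := w) (fun i s' => s'.reg 20 = w - i ∧ s'.reg 15 = i * m ∧
    ((∀ x < 15, s'.reg x = s.reg x) ∧ s'.reg 25 = s.reg 25) ∧
    (∀ x, s'.mem x = if a ≤ x ∧ x < a + K ^ m then
      ∑ i' ∈ Finset.range i, (if code i' = x - a then 1 else 0) else s.mem x))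
    (m * (3 * m + 17) + 8) ?_ ?_ ?_) ?_
  · exact fun i s' _ h => h.1
  · rintro i s₁ hi ⟨a1, a2, ⟨a5, a25⟩, a6⟩
    simp only [wp_seq, wp_add, wp_const]
    refine WP.mono (wp_loop (n := m) (fun j s' => s'.reg 21 = m - j ∧ s'.reg 15 = i * m + j ∧
      s'.reg 16 = enc K (boolVec (A ⟨i, hi⟩)) j ∧ s'.mem = s₁.mem ∧
      ((∀ x < 15, s'.reg x = s.reg x) ∧ s'.reg 25 = s.reg 25 ∧ s'.reg 20 = w - i))
      (3 * m + 16) ?_ ?_ ?_) ?_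
    · exact fun i s' _ h => h.1
    · rintro j s₂ hj ⟨b1, b2, b3, b5, ⟨b6, b25, b20⟩⟩
      simp only [wp_seq, wp_add, wp_load, wp_cond, wp_skip, wp_sub]
      refine (wp_shiftReg (by rw [b6 3 (by omega), h3]) (by rw [b6 4 (by omega), h4])
        (by omega) (by omega)).mono ?_
      rintro s₃ t₃ ⟨⟨c1, c2, c5⟩, ct⟩
      rw [b6 5 (by omega), h5] at c1 ct
      rw [b3, ← hK] at c1
      have c15 : s₃.reg 15 = i * m + j := by rw [c2 15 (by omega) (by omega), b2]
      have c4 : s₃.reg 4 = 1 := by rw [c2 4 (by omega) (by omega), b6 4 (by omega), h4]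
      have c21 : s₃.reg 21 = m - j := by rw [c2 21 (by omega) (by omega), b1]
      have c20 : s₃.reg 20 = w - i := by rw [c2 20 (by omega) (by omega), b20]
      have c25 : s₃.reg 25 = s.reg 25 := by rw [c2 25 (by omega) (by omega), b25]
      have hlt : i * m + j < w * m := by
        have := Nat.mul_le_mul_right m (Nat.succ_le_of_lt hi)
        rw [Nat.succ_mul] at this
        omega
      have hload : s₃.mem (i * m + j) = if A ⟨i, hi⟩ ⟨j, hj⟩ = true then 1 else 0 := by
        have hx := hentry _ hlt
        rw [c5, b5, a6, if_neg (by omega), hmem]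
        exact inputState_mem A k ⟨i, hi⟩ ⟨j, hj⟩
      simp only [reg_setReg, mem_setReg, reduceIte, Nat.reduceEqDiff, c15, c4, c21, hload]
      cases hA : A ⟨i, hi⟩ ⟨j, hj⟩
      · simp only [Bool.false_eq_true, reduceIte]
        refine ⟨⟨by omega, by omega, ?_, by rw [c5, b5], ?_, ?_, ?_⟩, by omega⟩
        · simp [c1, enc, boolVec, hj, hA, mul_comm]
        · intro x hx
          have : x ≠ 21 ∧ x ≠ 15 ∧ x ≠ 16 ∧ x ≠ 22 := by omega
          simp [this, c2 x this.2.2.1 (by omega), b6 x hx]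
        · simp [c25]
        · simp [c20]
      · simp only [reduceIte, one_ne_zero]
        refine ⟨⟨by omega, by omega, ?_, by rw [c5, b5], ?_, ?_, ?_⟩, by omega⟩
        · simp [c1, enc, boolVec, hj, hA, mul_comm]
        · intro x hx
          have : x ≠ 21 ∧ x ≠ 15 ∧ x ≠ 16 ∧ x ≠ 22 := by omega
          simp [this, c2 x this.2.2.1 (by omega), b6 x hx]
        · simp [c25]
        · simp [c20]
    · refine ⟨by simp [a5, h1, h3], by simp [a2], by simp [enc], by simp, ?_, by simp [a25],
        by simp [a1]⟩
      intro x hx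
      have : x ≠ 21 ∧ x ≠ 16 := by omega
      simp [this, a5 x hx]
    rintro s₂ t₂ ⟨⟨b1, b2, b3, b5, ⟨b6, b25, b20⟩⟩, bt⟩
    rw [show 3 * m + 16 + 1 = 3 * m + 17 from rfl] at bt
    simp only [wp_store, wp_load, wp_sub]
    have b4 : s₂.reg 4 = 1 := by rw [b6 4 (by omega), h4]
    have b10 : s₂.reg 10 = a := by rw [b6 10 (by omega), ha]
    have hcodei : enc K (boolVec (A ⟨i, hi⟩)) m = code i := by
      rw [hcode]
      simp [hi, rowCode]
    have hlt : code i < K ^ m := by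
      rw [hcode]
      simpa [hi] using rowCode_lt hK2 _
    rw [hcodei] at b3
    simp only [reg_setReg, mem_setReg, reg_setMem, mem_setMem, reduceIte, Nat.reduceEqDiff, b4, b10,
      b3, b20, b2]
    refine ⟨⟨by omega, by rw [Nat.succ_mul], ⟨?_, b25⟩, ?_⟩, by omega⟩
    · intro x hx
      have : x ≠ 20 ∧ x ≠ 23 ∧ x ≠ 24 := by omega
      simp [this, b6 x hx]
    · intro x
      by_cases hx : x = a + code i
      · subst hx
        have hin : a ≤ a + code i ∧ a + code i < a + K ^ m := by omega
        rw [if_pos rfl, Finset.sum_range_succ, b5, a6, if_pos hin, if_pos hin,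
          Nat.add_sub_cancel_left, if_pos rfl]
      · rw [if_neg hx, Finset.sum_range_succ, b5, a6 x]
        split_ifs <;> first | rfl | omega
  · refine ⟨by simp [h0, h3], by simp, ⟨fun x hx => ?_, by simp⟩, fun x => ?_⟩
    · have : x ≠ 20 ∧ x ≠ 15 := by omega
      simp [this]
    · have hz : a ≤ x → s.mem x = 0 := fun hx => by
        rw [hmem]
        simp only [inputState]
        rw [dif_neg (by omega)]
      simp only [mem_setReg, Finset.range_zero, Finset.sum_empty]
      split_ifs with hx
      · exact hz hx.1
      · rfl
  rintro s' t ⟨⟨a1, a2, ⟨a5, a25⟩, a6⟩, at1⟩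
  rw [show m * (3 * m + 17) + 8 + 1 = m * (3 * m + 17) + 9 from rfl] at at1
  refine ⟨⟨a5, a25, fun x => ?_⟩, by omega⟩
  rw [a6 x, hmult]

/-- Fill the table of halved vectors, with base address `reg 11`. -/
def halfTableProg : Prog :=
  block [
    .const 19 4,
    shiftReg 19 1,
    .add 15 11 3,
    .add 17 11 3,
    .add 20 7 3,
    .loop 20 (block [
      .load 18 15,
      shiftReg 18 5,
      .add 21 19 3,
      .loop 21 (block [
        .store 17 18,
        .add 17 17 4,
        .store 17 18,
        .add 17 17 4,
        .add 18 18 4,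
        .sub 21 21 4]),
      .add 15 15 4,
      .sub 20 20 4])]

/-- The indices `K * r + 2 * d` and `K * r + 2 * d + 1` receive the same value `K * v + d`, where
`v` is the entry at `r`, so `K / 2` rounds serve one `r`. -/
theorem wp_halfTableProg {s : State} {m K N : ℕ} (h1 : s.reg 1 = m) (h3 : s.reg 3 = 0)
    (h4 : s.reg 4 = 1) (h5 : s.reg 5 = m + 3) (h7 : s.reg 7 = N) (hK : K = 2 ^ (m + 3))
    (h0 : s.mem (s.reg 11) = 0) :
    WP halfTableProg s fun s' t =>
      ((∀ x < 15, s'.reg x = s.reg x) ∧ s'.reg 25 = s.reg 25 ∧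
        (∀ x < s.reg 11, s'.mem x = s.mem x) ∧ s'.mem (s.reg 11) = 0 ∧
        ∀ r < N, ∀ d < K, s'.mem (s.reg 11 + (K * r + d)) = K * s'.mem (s.reg 11 + r) + d / 2) ∧
      t ≤ N * (4 * K + 3 * m + 20) + 3 * m + 10 := by
  obtain ⟨a, ha⟩ : ∃ a, a = s.reg 11 := ⟨_, rfl⟩
  obtain ⟨q, hq⟩ : ∃ q, q = 4 * 2 ^ m := ⟨_, rfl⟩
  have hKq : K = 2 * q := by rw [hK, hq, pow_add]; ring
  have hq1 : 1 ≤ q := by have := Nat.one_le_two_pow (n := m); omega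
  rw [← ha] at h0
  rw [← ha]
  simp only [halfTableProg, block, wp_seq, wp_add, wp_const]
  refine (wp_shiftReg (by simpa using h3) (by simpa using h4) (by omega) (by omega)).mono ?_
  rintro s₁ t₁ ⟨⟨a1, a2, a5⟩, at1⟩
  simp only [reg_setReg, reduceIte, Nat.reduceEqDiff, h1, mem_setReg] at a1 a5 at1
  rw [← hq] at a1
  have a15 : ∀ x < 50, x ≠ 19 → s₁.reg x = s.reg x := fun x hx hx' => by
    rw [a2 x hx' hx, reg_setReg, if_neg hx']
  refine WP.mono (wp_loop (n := N) (fun r s' => s'.reg 20 = N - r ∧ s'.reg 15 = a + r ∧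
    s'.reg 17 = a + K * r ∧ s'.reg 19 = q ∧
    ((∀ x < 15, s'.reg x = s.reg x) ∧ s'.reg 25 = s.reg 25) ∧
    (∀ x < a, s'.mem x = s.mem x) ∧ s'.mem a = 0 ∧
    ∀ r' < r, ∀ d < K, s'.mem (a + (K * r' + d)) = K * s'.mem (a + r') + d / 2)
    (7 * q + 3 * m + 16) ?_ ?_ ?_) ?_
  · exact fun i s' _ h => h.1
  · rintro r s₂ hr ⟨b1, b2, b3, b4, ⟨b5, b25⟩, b6, b7, b8⟩
    simp only [wp_seq, wp_add, wp_load]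
    refine (wp_shiftReg (by simpa [b5] using h3) (by simpa [b5] using h4)
      (by omega) (by omega)).mono ?_
    rintro s₃ t₃ ⟨⟨c1, c2, c5⟩, ct⟩
    obtain ⟨v, hv⟩ : ∃ v, v = s₂.mem (a + r) := ⟨_, rfl⟩
    simp only [reg_setReg, reduceIte, Nat.reduceEqDiff, mem_setReg, b2, b5 5 (by omega), h5, ← hK,
      ← hv] at c1 c5 ct
    have c18 : ∀ x < 50, x ≠ 18 → s₃.reg x = s₂.reg x := fun x hx hx' => by
      rw [c2 x hx' hx, reg_setReg, if_neg hx']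
    -- The entry at `r` is final when it is read: the cells below `K * r` have been written already.
    -- For `r = 0` the initial `0` is read and written back.
    have hrK : r = 0 ∨ r < K * r := by
      rcases Nat.eq_zero_or_pos r with h | h
      · exact Or.inl h
      · right
        have : 2 * r ≤ K * r := Nat.mul_le_mul_right r (by omega)
        omega
    refine WP.mono (wp_loop (n := q) (fun d s' => s'.reg 21 = q - d ∧
      s'.reg 17 = a + (K * r + 2 * d) ∧ s'.reg 18 = K * v + d ∧
      ((∀ x < 17, s'.reg x = s₂.reg x) ∧ s'.reg 19 = q ∧ s'.reg 20 = N - r ∧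
        s'.reg 25 = s.reg 25) ∧
      (∀ x < a + K * r, s'.mem x = s₂.mem x) ∧
      ∀ e < 2 * d, s'.mem (a + (K * r + e)) = K * v + e / 2) 6 ?_ ?_ ?_) ?_
    · exact fun i s' _ h => h.1
    · rintro d s₄ hd ⟨d1, d2, d3, ⟨d4, d19, d20, d25⟩, d5, d6⟩
      have d44 : s₄.reg 4 = 1 := by rw [d4 4 (by omega), b5 4 (by omega), h4]
      simp only [wp_seq, wp_add, wp_store, wp_sub]
      simp only [reg_setReg, mem_setReg, reg_setMem, mem_setMem, reduceIte, Nat.reduceEqDiff, d1, d2,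
        d3, d44]
      refine ⟨⟨by omega, by omega, by omega, ⟨?_, d19, d20, d25⟩, ?_, ?_⟩, by omega⟩
      · intro x hx
        have : x ≠ 17 ∧ x ≠ 18 ∧ x ≠ 21 := by omega
        simp [this, d4 x hx]
      · intro x hx
        rw [if_neg (by omega), if_neg (by omega), d5 x hx]
      · intro e he
        by_cases h2 : e < 2 * d
        · rw [if_neg (by omega), if_neg (by omega), d6 e h2]
        · split_ifs <;> omega
    · refine ⟨?_, ?_, ?_, ⟨fun x hx => ?_, ?_, ?_, ?_⟩, ?_, ?_⟩
      · simp [c18, b4, b5, h3]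
      · simp [c18, b3]
      · simp [c1, mul_comm]
      · have : x ≠ 21 := by omega
        simp [this, c18 x (by omega) (by omega)]
      · simp [c18, b4]
      · simp [c18, b1]
      · simp [c18, b25]
      · simp [c5]
      · intro e he; omega
    rintro s₄ t₄ ⟨⟨d1, d2, d3, ⟨d4, d19, d20, d25⟩, d5, d6⟩, dt⟩
    have d44 : s₄.reg 4 = 1 := by rw [d4 4 (by omega), b5 4 (by omega), h4]
    have ev : r = 0 → v = 0 := fun h => by rw [hv, h]; exact b7
    have hold : s₄.mem (a + r) = v := by
      rcases hrK with h | h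
      · have := d6 0 (by omega)
        rw [h] at this ⊢
        simpa [ev h] using this
      · rw [d5 _ (by omega), hv]
    have hzero : s₄.mem a = 0 := by
      rcases hrK with h | h
      · rw [h] at hold
        rw [← ev h, ← hold]
        rfl
      · rw [d5 _ (by omega), b7]
    simp only [wp_sub]
    simp only [reg_setReg, mem_setReg, reduceIte, Nat.reduceEqDiff, d44, d20, d2, d4 15 (by omega), b2]
    refine ⟨⟨by omega, by omega, by rw [hKq]; ring, d19, ⟨?_, d25⟩, ?_, hzero, ?_⟩, by omega⟩
    · intro x hx
      have : x ≠ 15 ∧ x ≠ 20 := by omega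
      simp [this, d4 x (by omega), b5 x hx]
    · intro x hx
      rw [d5 x (by omega), b6 x hx]
    · intro r' hr' d hd
      rcases Nat.lt_succ_iff_lt_or_eq.1 hr' with h | rfl
      · have h2 : K * r' + K ≤ K * r := by
          rw [← Nat.mul_succ]
          exact Nat.mul_le_mul_left _ h
        have h3 : r ≤ K * r := Nat.le_mul_of_pos_left _ (by omega)
        rw [d5 _ (by omega), d5 _ (by omega), b8 r' h d hd]
      · rw [d6 d (by omega), hold]
  · have e11 : s₁.reg 11 = a := by rw [a15 11 (by omega) (by omega), ha]
    have e3 : s₁.reg 3 = 0 := by rw [a15 3 (by omega) (by omega), h3]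
    have e7 : s₁.reg 7 = N := by rw [a15 7 (by omega) (by omega), h7]
    refine ⟨?_, ?_, ?_, ?_, ⟨fun x hx => ?_, ?_⟩, ?_, ?_, ?_⟩
    · simp [e7, e3]
    · simp [e11, e3]
    · simp [e11, e3]
    · simp [a1]
    · have : x ≠ 15 ∧ x ≠ 17 ∧ x ≠ 20 := by omega
      simp [this, a15 x (by omega) (by omega)]
    · simp [a15]
    · simp [a5]
    · simp [a5, h0]
    · intro r hr; omega
  rintro s' t ⟨⟨b1, b2, b3, b4, ⟨b5, b25⟩, b6, b7, b8⟩, bt⟩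
  refine ⟨⟨b5, b25, b6, b7, b8⟩, ?_⟩
  have : N * (7 * q + 3 * m + 16 + 1) ≤ N * (4 * K + 3 * m + 20) :=
    Nat.mul_le_mul_left _ (by omega)
  omega

/-! ### The complete program -/

/-- The program that decides Lobbying. -/
def lobbyProg : Prog :=
  block [
    paramProg,
    countProg,
    halfTableProg,
    .add 15 9 8,
    .store 15 4,
    .add 12 0 3,
    .const 13 1,
    .add 14 0 3,
    .loop 14 levelProg,
    .load 15 9,
    .sub 16 2 0,
    .sub 17 0 2,
    .sub 18 15 17,
    .cond 16 (.const 0 0) (.cond 18 (.const 0 1) (.const 0 0))]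

/-- After the last level, the entry of the zero vector decides the instance. -/
theorem LevelState.lobbying_iff {w m k K W : ℕ} {A : Matrix (Fin w) (Fin m) Bool}
    {U : ℕ → ℕ} {R : Set ((ℕ → ℕ) × ℕ)} {s : State} (hK : 2 ≤ K)
    (h : LevelState m K w k (codeVec K A) U 0 W R s) (hU : ∀ Z, U Z = 0)
    (hV : Vals m (K ^ m) (codeVec K A) U 0 W R =
      Vals m (K ^ m) (codeVec K A) (mult K A) w 1 {(fun _ => 1, 0)}) :
    Lobbying A k ↔ k ≤ w ∧ w - k < s.mem (s.reg 9) := by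
  have hiff : ∀ x, (∃ p ∈ R, (∀ j < m, p.1 j = 0) ∧ x = p.2) ↔
      ∃ S : Finset (Fin w), S.card = x ∧ Keepable A S := fun x => by
    rw [← Vals_end (N := K ^ m) (z := codeVec K A) (W := W) hU, hV, mem_Vals_start hK]
  rw [RAM.lobbying_iff, ← hiff]
  refine and_congr_right fun _ => ⟨?_, fun hlt => ?_⟩
  · rintro ⟨p, hp, h0, hx⟩
    have h1 := (h.rep.1 p hp).2
    rw [(enc_eq_zero (by omega)).2 h0] at h1
    rw [hx]
    exact h1
  · obtain ⟨p, hp, h0, hv⟩ := h.rep.2 0 (Nat.pow_pos (by omega)) (Nat.ne_zero_of_lt hlt)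
    obtain ⟨S, hS, hk⟩ := (hiff p.2).1 ⟨p, hp, (enc_eq_zero (by omega)).1 h0, rfl⟩
    simp only [add_zero] at hv
    -- The table yields only a keepable set of at least `w - k` rows; a subset has exactly that
    -- size.
    obtain ⟨S', hS', hc⟩ := Finset.exists_subset_card_eq (show w - k ≤ S.card by omega)
    exact (hiff _).2 ⟨S', hc, hk.subset hS'⟩

theorem wp_lobbyProg {w m k K : ℕ} (A : Matrix (Fin w) (Fin m) Bool) (hK : K = 8 * 2 ^ m) :
    WP lobbyProg (inputState A k) fun s t =>
      ((Lobbying A k → s.reg 0 = 1) ∧ (¬ Lobbying A k → s.reg 0 = 0)) ∧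
      t ≤ (m * (6 * m + 25) + 3 * m + 3 * w + 25) + (w * (m * (3 * m + 17) + 9) + 3) +
        (K ^ m * (4 * K + 3 * m + 20) + 3 * m + 10) +
        w * (K ^ m * (3 * w + 32 * K ^ m + 66) + 3 * w + 31) + 20 := by
  have hK' : K = 2 ^ (m + 3) := by rw [hK, pow_add]; ring
  have hpow : 1 ≤ 2 ^ m := Nat.one_le_two_pow
  have hK2 : 2 ≤ K := by omega
  obtain ⟨N, hN⟩ : ∃ N, N = K ^ m := ⟨_, rfl⟩
  have hN0 : 0 < N := by rw [hN]; exact Nat.pow_pos (by omega)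
  have hone : enc K (fun _ => 1) m < N := by rw [hN]; exact enc_lt fun _ _ => by omega
  simp only [lobbyProg, block, wp_seq, wp_add, wp_const, wp_store]
  refine (wp_paramProg (w := w) (m := m) (by simp [inputState]) (by simp [inputState])
    (by simp [inputState])).mono ?_
  rintro s₁ t₁ ⟨⟨a0, a1, a2, a3, a4, a5, a6, a7, a8, a9, a10, a11, a25, amem⟩, at1⟩
  rw [← hK'] at a6 a7 a8
  rw [← hN] at a7
  have a2' : s₁.reg 2 = k := by rw [a2]; simp [inputState]
  rw [a7, a9] at a10
  rw [a7, a10] at a11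
  refine (wp_countProg a0 a1 a3 a4 a5 hK' (by omega) amem).mono ?_
  rintro s₂ t₂ ⟨⟨b1, b25, b5⟩, bt⟩
  rw [a10, ← hN] at b5
  have hin : ∀ x, w * m ≤ x → s₁.mem x = 0 := fun x hx => by
    rw [amem]
    simp only [inputState]
    rw [dif_neg (by omega)]
  have b11 : s₂.reg 11 = w * m + N + N := by rw [b1 11 (by omega), a11]
  refine (wp_halfTableProg (N := N) (by rw [b1 1 (by omega), a1]) (by rw [b1 3 (by omega), a3])
    (by rw [b1 4 (by omega), a4]) (by rw [b1 5 (by omega), a5]) (by rw [b1 7 (by omega), a7])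
    hK' ?_).mono ?_
  · rw [b11, b5, if_neg (by omega), hin _ (by omega)]
  rintro s₃ t₃ ⟨⟨c1, c25, c5, c6, c7⟩, ct⟩
  have d : ∀ x < 15, s₃.reg x = s₁.reg x := fun x hx => by rw [c1 x hx, b1 x hx]
  have d0 : s₃.reg 0 = w := by rw [d 0 (by omega), a0]
  have d2 : s₃.reg 2 = k := by rw [d 2 (by omega), a2']
  have d3 : s₃.reg 3 = 0 := by rw [d 3 (by omega), a3]
  have d4 : s₃.reg 4 = 1 := by rw [d 4 (by omega), a4]
  have d7 : s₃.reg 7 = N := by rw [d 7 (by omega), a7]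
  have d8 : s₃.reg 8 = enc K (fun _ => 1) m := by rw [d 8 (by omega), a8]
  have d9 : s₃.reg 9 = w * m := by rw [d 9 (by omega), a9]
  have d10 : s₃.reg 10 = w * m + N := by rw [d 10 (by omega), a10]
  have d11 : s₃.reg 11 = w * m + N + N := by rw [d 11 (by omega), a11]
  have d25 : s₃.reg 25 = 2 := by rw [c25, b25, a25]
  rw [b11] at c5 c6 c7
  have hmem : ∀ x < w * m + N + N, s₃.mem x = if w * m + N ≤ x then mult K A (x - (w * m + N)) else
      s₁.mem x := fun x hx => by
    rw [c5 x hx, b5]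
    split_ifs <;> first | rfl | omega
  -- A positive multiplicity or bound drops by at least one per level, so both are `0` after `w`
  -- levels. Logarithmically many would do, but the counter `w` is at hand and costs only a
  -- polynomial factor; `Vals_step` also holds for levels in which nothing is left.
  refine WP.mono (wp_loop (n := w) (fun i s => ∃ U b W R,
    LevelState m K w k (codeVec K A) U b W R s ∧ s.reg 14 = w - i ∧ (∀ Z, U Z ≤ w - i) ∧ b ≤ w - i ∧
    Vals m (K ^ m) (codeVec K A) U b W R =
      Vals m (K ^ m) (codeVec K A) (mult K A) w 1 {(fun _ => 1, 0)})
    (K ^ m * (3 * w + 32 * K ^ m + 66) + 3 * w + 30) ?_ ?_ ?_) ?_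
  · rintro i s _ ⟨U, b, W, R, -, h, -⟩
    exact h
  · rintro i s hi ⟨U, b, W, R, h, h14, hU, hb, hV⟩
    refine (wp_levelProg hK h).mono ?_
    rintro s' t ⟨⟨h', h14'⟩, ht⟩
    refine ⟨⟨_, _, _, _, h', by omega, fun Z => ?_, by omega, ?_⟩, ht⟩
    · have := hU Z
      omega
    · rw [levelSet, Vals_step, hV]
  · refine ⟨mult K A, w, 1, {(fun _ => 1, 0)}, ?_, by simp [d0, d3], fun Z => mult_le Z, le_rfl, rfl⟩
    exact {
      reg_zero := by simp [d0]
      reg_two := by simp [d2]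
      reg_three := by simp [d3]
      reg_four := by simp [d4]
      reg_seven := by simp [d7, hN]
      reg_eight := by simp [d8]
      reg_ten := by simp [d9, d10, hN]
      reg_eleven := by simp [d10, d11, hN]
      reg_twelve := by simp [d0, d3]
      reg_thirteen := by simp
      reg_twentyfive := by simp [d25]
      bound_le := le_rfl
      vec_le := codeVec_le
      vec_code := fun Z hZ => enc_codeVec hK2 hZ
      mult_zero := fun Z hZ => mult_eq_zero hK2 hZ
      mult_le := mult_le
      card_le := card_mult_ne_zero _
      reached_le := by
        rintro _ rfl j _
        dsimp only
        omega
      mem_mult := fun c hc => by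
        rw [← hN] at hc
        simp only [reg_setReg, mem_setReg, reg_setMem, mem_setMem, reduceIte, Nat.reduceEqDiff,
          d8, d9, d10]
        rw [if_neg (by omega), hmem _ (by omega), if_pos (by omega), Nat.add_sub_cancel_left]
      mem_half_zero := by
        simp only [reg_setReg, mem_setReg, reg_setMem, mem_setMem, reduceIte, Nat.reduceEqDiff,
          d8, d9, d11]
        rw [if_neg (by omega), c6]
      mem_half := fun r hr d hd => by
        rw [← hN] at hr
        simp only [reg_setReg, mem_setReg, reg_setMem, mem_setMem, reduceIte, Nat.reduceEqDiff,
          d8, d9, d11]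
        rw [if_neg (by omega), if_neg (by omega), c7 r hr d hd]
      rep := by
        -- The table lies beyond the input and below the multiplicities, so it is zero except at the
        -- all-ones code, where `1` stands for the value `0`.
        have hT : ∀ c < N, (if w * m + c = w * m + enc K (fun _ => 1) m then 1 else
            s₃.mem (w * m + c)) = if c = enc K (fun _ => 1) m then 1 else 0 := fun c hc => by
          rw [hmem _ (by omega), if_neg (show ¬ w * m + N ≤ w * m + c by omega), hin _ (by omega)]
          simp
        simp only [reg_setReg, mem_setReg, reg_setMem, mem_setMem, reduceIte, Nat.reduceEqDiff,
          d4, d8, d9]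
        refine Rep.congr (T := fun c => if c = enc K (fun _ => 1) m then 1 else 0) ⟨?_, ?_⟩
          (fun c hc => hT c (by rwa [hN]))
        · rintro _ rfl
          exact ⟨by rwa [← hN], by simp⟩
        · intro c _ h0
          have hc : c = enc K (fun _ => 1) m := by
            by_contra hne
            exact h0 (if_neg hne)
          exact ⟨_, rfl, hc.symm, by simp [hc]⟩ }
  rintro s₄ t₄ ⟨⟨U, b, W, R, h, h14, hU, hb, hV⟩, et⟩
  have hb0 : b = 0 := by omega
  subst hb0
  have hU0 : ∀ Z, U Z = 0 := fun Z => by have := hU Z; omega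
  have hiff := h.lobbying_iff hK2 hU0 hV
  rw [show K ^ m * (3 * w + 32 * K ^ m + 66) + 3 * w + 30 + 1 =
    K ^ m * (3 * w + 32 * K ^ m + 66) + 3 * w + 31 from rfl] at et
  rw [hN] at ct
  simp only [wp_load, wp_sub, wp_cond, wp_const]
  simp only [reg_setReg, reduceIte, Nat.reduceEqDiff, h.reg_zero, h.reg_two]
  split_ifs with h1 h2
  · refine ⟨⟨fun hL => ?_, fun _ => trivial⟩, by omega⟩
    have := hiff.1 hL
    omega
  · refine ⟨⟨fun _ => trivial, fun hL => absurd (hiff.2 ⟨by omega, by omega⟩) hL⟩, by omega⟩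
  · refine ⟨⟨fun hL => ?_, fun _ => trivial⟩, by omega⟩
    have := hiff.1 hL
    omega

/-! ### The running time -/

/-- With `E = 2 ^ m ^ 2` and `V = w + 1`, all of `m`, `2 ^ m` and `K / 8` are at most `E`, and `K ^
m ≤ E ^ 4`. Every monomial of the count is then at most `E ^ 8 * V ^ 2`, and `1000` generously
covers both coefficients and exponents. -/
theorem step_bound (w m K : ℕ) (hK : K = 8 * 2 ^ m) :
    (m * (6 * m + 25) + 3 * m + 3 * w + 25) + (w * (m * (3 * m + 17) + 9) + 3) +
        (K ^ m * (4 * K + 3 * m + 20) + 3 * m + 10) +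
        w * (K ^ m * (3 * w + 32 * K ^ m + 66) + 3 * w + 31) + 20 ≤
      1000 * 2 ^ (1000 * m ^ 2) * (w + 1) ^ 1000 := by
  obtain ⟨E, hE⟩ : ∃ E, E = 2 ^ m ^ 2 := ⟨_, rfl⟩
  obtain ⟨V, hV⟩ : ∃ V, V = w + 1 := ⟨_, rfl⟩
  have hE1 : 1 ≤ E := by rw [hE]; exact Nat.one_le_two_pow
  have hV1 : 1 ≤ V := by omega
  have h2m : 2 ^ m ≤ E := by
    rw [hE]
    exact Nat.pow_le_pow_right (by omega) (Nat.le_self_pow (by omega) m)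
  have hm : m ≤ E := Nat.lt_two_pow_self.le.trans h2m
  have hKE : K ≤ 8 * E := by omega
  have hNE : K ^ m ≤ E ^ 4 := by
    rw [hK, show 8 * 2 ^ m = 2 ^ (m + 3) by rw [pow_add]; ring, ← pow_mul, hE, ← pow_mul]
    refine Nat.pow_le_pow_right (by omega) ?_
    -- The exponents compare as `(m + 3) * m ≤ 4 * m ^ 2`, which for positive `m` follows from `3 *
    -- m ≤ 3 * m ^ 2`.
    rcases Nat.eq_zero_or_pos m with h | h
    · simp [h]
    · nlinarith
  have hwV : w ≤ V := by omega
  have hX : ∀ a b, a ≤ 8 → b ≤ 2 → E ^ a * V ^ b ≤ E ^ 8 * V ^ 2 := fun a b ha hb =>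
    Nat.mul_le_mul (Nat.pow_le_pow_right hE1 ha) (Nat.pow_le_pow_right hV1 hb)
  have h1 : (m * (6 * m + 25) + 3 * m + 3 * w + 25) + (w * (m * (3 * m + 17) + 9) + 3) +
        (K ^ m * (4 * K + 3 * m + 20) + 3 * m + 10) +
        w * (K ^ m * (3 * w + 32 * K ^ m + 66) + 3 * w + 31) + 20 ≤
      (E * (6 * E + 25) + 3 * E + 3 * V + 25) + (V * (E * (3 * E + 17) + 9) + 3) +
        (E ^ 4 * (4 * (8 * E) + 3 * E + 20) + 3 * E + 10) +
        V * (E ^ 4 * (3 * V + 32 * E ^ 4 + 66) + 3 * V + 31) + 20 := by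
    gcongr
  have h2 : (E * (6 * E + 25) + 3 * E + 3 * V + 25) + (V * (E * (3 * E + 17) + 9) + 3) +
        (E ^ 4 * (4 * (8 * E) + 3 * E + 20) + 3 * E + 10) +
        V * (E ^ 4 * (3 * V + 32 * E ^ 4 + 66) + 3 * V + 31) + 20 ≤ 1000 * (E ^ 8 * V ^ 2) := by
    have e00 := hX 0 0 (by omega) (by omega)
    have e10 := hX 1 0 (by omega) (by omega)
    have e20 := hX 2 0 (by omega) (by omega)
    have e40 := hX 4 0 (by omega) (by omega)
    have e50 := hX 5 0 (by omega) (by omega)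
    have e01 := hX 0 1 (by omega) (by omega)
    have e11 := hX 1 1 (by omega) (by omega)
    have e21 := hX 2 1 (by omega) (by omega)
    have e41 := hX 4 1 (by omega) (by omega)
    have e81 := hX 8 1 (by omega) (by omega)
    have e02 := hX 0 2 (by omega) (by omega)
    have e42 := hX 4 2 (by omega) (by omega)
    ring_nf at *
    omega
  have h5 : E ^ 8 ≤ 2 ^ (1000 * m ^ 2) := by
    rw [hE, ← pow_mul]
    exact Nat.pow_le_pow_right (by omega) (by nlinarith)
  have h6 : V ^ 2 ≤ V ^ 1000 := Nat.pow_le_pow_right hV1 (by simp)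
  rw [mul_assoc, ← hV]
  exact h1.trans (h2.trans (Nat.mul_le_mul_left _ (Nat.mul_le_mul h5 h6)))

end RAM

theorem mainTheorem5 :
    ∃ (P : RAM.Prog) (C : ℕ),
      ∀ (w m k : ℕ) (A : Matrix (Fin w) (Fin m) Bool),
        ∃ (s : RAM.State) (t : ℕ),
          RAM.Exec P (RAM.inputState A k) s t ∧
          (Lobbying A k → s.reg 0 = 1) ∧
          (¬ Lobbying A k → s.reg 0 = 0) ∧
          t ≤ C * 2 ^ (C * m ^ 2) * (w + 1) ^ C := by
  refine ⟨RAM.lobbyProg, 1000, fun w m k A => ?_⟩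
  obtain ⟨s, t, he, ⟨h1, h2⟩, ht⟩ := RAM.wp_lobbyProg (k := k) A rfl
  exact ⟨s, t, he, h1, h2, ht.trans (RAM.step_bound w m _ rfl)⟩
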